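/- All manifolds are smooth. A \emph{filtered bundle} $\pi:E\to B$ is a fibre bundle with typical fibre $\mathbb{R}^N$, together with an atlas of local trivializations whose fibre coordinates $X^A$ carry fixed weights $w_A\in\mathbb{N}\setminus\{0\}$, such that in every change of trivialization $X^{A'}$ is a polynomial in the old fibre coordinates, with coefficients smooth on the base, all of whose monomials $X^{A_1}\cdots X^{A_n}$ satisfy $w_{A_1}+\dots+w_{A_n}\le w_{A'}$. It is of degree $l$ if all weights are at most $l$. A \emph{double filtered bundle} of bi-degree $(l,k)$ is defined likewise with bi-weights $(u_A,v_A)\in([0,l]\times[0,k])\setminus\{(0,0)\}$, where the monomials occurring in $X^{A'}$ satisfy both $\sum_i u_{A_i}\le u_{A'}$ and $\sum_i v_{A_i}\le v_{A'}$. **Theorem.** Let $\pi:F\to M$ be a filtered bundle of degree $l$ over a (Hausdorff, second countable) manifold $M$ of dimension $m$, with fibre coordinates $Y^I$ of weights $w_I$, and let $k\ge 0$. Let $J^kF$ be the set of $k$-jets $j^k_xs$ of local smooth sections of $\pi$. For adapted fibre coordinates $Y^I$ on $F$ over $U\subset M$ and local coordinates $\varphi=(x^a)$ on $M$ put $$Y^I_{\alpha}(j^k_xs)=\partial^{\alpha}\bigl(Y^I\circ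 s\circ\varphi^{-1}\bigr)(\varphi(x)),\qquad |\alpha|\le k .$$ 1. There is a unique smooth manifold structure on $J^kF$ for which all these systems $(Y^I_\alpha)$ are the fibre coordinates of smooth local trivializations of $J^kF\to M$ (over the intersection of $U$ with the domain of $\varphi$); it is Hausdorff and second countable. 2. The trivializations given by the jet coordinates $Y^I_\alpha$, with bi-weights $(w_I,|\alpha|)$, make $J^kF\to M$ a double filtered bundle of bi-degree $(l,k)$. Every bi-weight $(w_I,0)$ occurs, and if $m>0$, so does every $(w_I,v)$ with $0\le v\le k$. 3. The first of its two filtered structures is over $M$: with the first weights $w_I$, $J^kF\to M$ is a filtered bundle of degree $l$. The second is over $F$: the jet coordinates with $\alpha=0$ are fibre coordinates on $F\to M$, and those with $|\alpha|\ge 1$, with weights $|\alpha|$, are the adapted fibre coordinates that make $J^kF\to F$, $j^k_xs\mapsto s(x)$, a filtered bundle of degree $k$. -/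

import Mathlib

open scoped Manifold ContDiff Topology

noncomputable section

namespace FilteredJet

/-! ### Filtered and double filtered bundles

The base `B` and the total space `E` are smooth manifolds (without boundary) modelled on the normed
spaces `EB` and `EE`. The typical fibre is `ℝ^κ`, with `κ` finite. An adapted coordinate system
is a local trivialization over an open subset of the base, whose second component lists the fibre
coordinates. -/

section Bundles

variable {EB EE : Type*} [NormedAddCommGroup EB] [NormedSpace ℝ EB]
  [NormedAddCommGroup EE] [NormedSpace ℝ EE]
  {B E : Type*} [TopologicalSpace B] [ChartedSpace EB B] [TopologicalSpace E] [ChartedSpace EE E]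
  {κ : Type*} [Fintype κ]

/-- The local trivialization `e` of `π : E → B` is a diffeomorphism of `π ⁻¹ U` onto `U × ℝ^κ`. -/
def IsSmoothTriv (EB EE : Type*) [NormedAddCommGroup EB] [NormedSpace ℝ EB]
    [NormedAddCommGroup EE] [NormedSpace ℝ EE]
    {B E : Type*} [TopologicalSpace B] [ChartedSpace EB B]
    [TopologicalSpace E] [ChartedSpace EE E] {κ : Type*} [Fintype κ]
    {π : E → B} (e : Bundle.Trivialization (κ → ℝ) π) : Prop :=
  ContMDiffOn 𝓘(ℝ, EE) (𝓘(ℝ, EB).prod 𝓘(ℝ, κ → ℝ)) ∞ e e.source ∧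
  ContMDiffOn (𝓘(ℝ, EB).prod 𝓘(ℝ, κ → ℝ)) 𝓘(ℝ, EE) ∞ e.toOpenPartialHomeomorph.symm e.target

/-- Over the overlap of the two domains, the `A`-th fibre coordinate of `e'` is a polynomial in the
fibre coordinates of `e`, whose coefficients are smooth functions on the base and which
satisfies the condition `D`. -/
def PolyTransition (EB : Type*) [NormedAddCommGroup EB] [NormedSpace ℝ EB]
    {B E : Type*} [TopologicalSpace B] [ChartedSpace EB B] [TopologicalSpace E] {κ : Type*}
    {π : E → B} (e e' : Bundle.Trivialization (κ → ℝ) π) (A : κ) (D : MvPolynomial κ ℝ → Prop) : Prop :=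
  ∃ P : B → MvPolynomial κ ℝ,
    (∀ n : κ →₀ ℕ, ContMDiffOn 𝓘(ℝ, EB) 𝓘(ℝ, ℝ) ∞ (fun x => (P x).coeff n)
      (e.baseSet ∩ e'.baseSet)) ∧
    ∀ x ∈ e.baseSet ∩ e'.baseSet, D (P x) ∧
      ∀ y : κ → ℝ, (e' (e.toOpenPartialHomeomorph.symm (x, y))).2 A = MvPolynomial.eval y (P x)

/-- A filtered bundle structure on `π : E → B` whose fibre coordinates `X^A` have the (non-zero)
weights `wt A`: an atlas of local trivializations whose transition laws express each new fibre
coordinate as a polynomial, of weighted degree at most the weight of this coordinate, in the old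
fibre coordinates. -/
structure FilteredBundle (EB EE : Type*) [NormedAddCommGroup EB] [NormedSpace ℝ EB]
    [NormedAddCommGroup EE] [NormedSpace ℝ EE]
    {B E : Type*} [TopologicalSpace B] [ChartedSpace EB B]
    [TopologicalSpace E] [ChartedSpace EE E] {κ : Type*} [Fintype κ]
    (π : E → B) (wt : κ → ℕ) where
  atlas : Set (Bundle.Trivialization (κ → ℝ) π)
  wt_ne_zero : ∀ A, wt A ≠ 0
  cover : ∀ x : B, ∃ e ∈ atlas, x ∈ e.baseSet
  smooth : ∀ e ∈ atlas, IsSmoothTriv EB EE e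
  transition : ∀ e ∈ atlas, ∀ e' ∈ atlas, ∀ A,
    PolyTransition EB e e' A fun P => P.weightedTotalDegree wt ≤ wt A

/-- A double filtered bundle structure on `π : E → B` whose fibre coordinates `Z^A` have the
bi-weights `wt A = (u, v) ≠ (0, 0)`: the transition polynomial of `Z^A` contains only monomials of
first weight at most `u` and of second weight at most `v`. -/
structure DoubleFilteredBundle (EB EE : Type*) [NormedAddCommGroup EB] [NormedSpace ℝ EB]
    [NormedAddCommGroup EE] [NormedSpace ℝ EE]
    {B E : Type*} [TopologicalSpace B] [ChartedSpace EB B]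
    [TopologicalSpace E] [ChartedSpace EE E] {κ : Type*} [Fintype κ]
    (π : E → B) (wt : κ → ℕ × ℕ) where
  atlas : Set (Bundle.Trivialization (κ → ℝ) π)
  wt_ne_zero : ∀ A, wt A ≠ (0, 0)
  cover : ∀ x : B, ∃ e ∈ atlas, x ∈ e.baseSet
  smooth : ∀ e ∈ atlas, IsSmoothTriv EB EE e
  transition : ∀ e ∈ atlas, ∀ e' ∈ atlas, ∀ A, PolyTransition EB e e' A fun P =>
    P.weightedTotalDegree (fun C => (wt C).1) ≤ (wt A).1 ∧
    P.weightedTotalDegree (fun C => (wt C).2) ≤ (wt A).2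

/-- Let `v` be one of the two weights of the fibre coordinates of `π = r ∘ q : E → N → B`. The
adapted coordinates `t` of `E` over `B` split, with respect to `v`, into

* the coordinates of weight `v = 0`, which are fibre coordinates `b` of `N` over the same open
  subset of `B`, and
* the coordinates of weight `v ≠ 0`, which are the fibre coordinates `c` of `q : E → N`. -/
def CoordSplit (EB EN : Type*) [NormedAddCommGroup EB] [NormedSpace ℝ EB]
    [NormedAddCommGroup EN] [NormedSpace ℝ EN]
    {B N E : Type*} [TopologicalSpace B] [ChartedSpace EB B]
    [TopologicalSpace N] [ChartedSpace EN N] [TopologicalSpace E] {κ : Type*} [Fintype κ]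
    {π : E → B} (v : κ → ℕ) (r : N → B) {q : E → N} (t : Bundle.Trivialization (κ → ℝ) π)
    (c : Bundle.Trivialization ({A : κ // v A ≠ 0} → ℝ) q) : Prop :=
  ∃ b : Bundle.Trivialization ({A : κ // v A = 0} → ℝ) r, IsSmoothTriv EB EN b ∧
    b.baseSet = t.baseSet ∧ c.baseSet = r ⁻¹' t.baseSet ∧
    ∀ z ∈ t.source, (∀ A, (b (q z)).2 A = (t z).2 A) ∧ ∀ A, (c z).2 A = (t z).2 A

/-- `S` is the filtered bundle structure over `N` that the double filtered bundle `D` over `B` has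
with respect to the weight `v` (one of its two weights): `q : E → N` lies over `B` and, with the
weights `v`, is a filtered bundle whose adapted coordinates are those of `D`, in which the
coordinates of weight `v = 0` become coordinates on `N`. -/
structure IsStructureOver {EB EN EE : Type*} [NormedAddCommGroup EB] [NormedSpace ℝ EB]
    [NormedAddCommGroup EN] [NormedSpace ℝ EN] [NormedAddCommGroup EE] [NormedSpace ℝ EE]
    {B N E : Type*} [TopologicalSpace B] [ChartedSpace EB B]
    [TopologicalSpace N] [ChartedSpace EN N] [TopologicalSpace E] [ChartedSpace EE E]
    {κ : Type*} [Fintype κ] {π : E → B} {wt : κ → ℕ × ℕ}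
    (D : DoubleFilteredBundle EB EE π wt) (v : κ → ℕ) (r : N → B) {q : E → N}
    (S : FilteredBundle EN EE q fun A : {A : κ // v A ≠ 0} => v A) : Prop where
  comm : ∀ z, r (q z) = π z
  exists_split : ∀ t ∈ D.atlas, ∃ c ∈ S.atlas, CoordSplit EB EN v r t c
  split_exists : ∀ c ∈ S.atlas, ∃ t ∈ D.atlas, CoordSplit EB EN v r t c

end Bundles

/-! ### Jets of sections -/

/-- The model space `ℝ^m`. -/
abbrev Euc (m : ℕ) : Type := EuclideanSpace ℝ (Fin m)

section Jets

variable {m : ℕ} {M : Type*} [TopologicalSpace M] [ChartedSpace (Euc m) M]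
  {EF : Type*} [NormedAddCommGroup EF] [NormedSpace ℝ EF]
  {F : Type*} [TopologicalSpace F] [ChartedSpace EF F]

/-- Smooth sections of `π : F → M` defined on a neighbourhood of `x` (the values of the function
outside this neighbourhood play no role). -/
structure LocalSection (m : ℕ) {M : Type*} [TopologicalSpace M] [ChartedSpace (Euc m) M]
    (EF : Type*) [NormedAddCommGroup EF] [NormedSpace ℝ EF]
    {F : Type*} [TopologicalSpace F] [ChartedSpace EF F] (π : F → M) (x : M) where
  toFun : M → F
  isSection : ∀ᶠ y in 𝓝 x, π (toFun y) = y
  smooth : ∀ᶠ y in 𝓝 x, ContMDiffAt 𝓘(ℝ, Euc m) 𝓘(ℝ, EF) ∞ toFun y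

/-- Two local sections are in contact to order `k` at `x`: they have the same value at `x` and, in
local coordinates, the same derivatives at `x` up to order `k`. -/
def Contact (k : ℕ) {π : F → M} {x : M} (s s' : LocalSection m EF π x) : Prop :=
  s.toFun x = s'.toFun x ∧ ∀ j ≤ k,
    iteratedFDeriv ℝ j (writtenInExtChartAt 𝓘(ℝ, Euc m) 𝓘(ℝ, EF) x s.toFun)
      (extChartAt 𝓘(ℝ, Euc m) x x) =
    iteratedFDeriv ℝ j (writtenInExtChartAt 𝓘(ℝ, Euc m) 𝓘(ℝ, EF) x s'.toFun)
      (extChartAt 𝓘(ℝ, Euc m) x x)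

/-- Contact to order `k` at `x` as an equivalence relation. -/
def contactSetoid (m : ℕ) {M : Type*} [TopologicalSpace M] [ChartedSpace (Euc m) M]
    (EF : Type*) [NormedAddCommGroup EF] [NormedSpace ℝ EF]
    {F : Type*} [TopologicalSpace F] [ChartedSpace EF F] (π : F → M) (k : ℕ) (x : M) :
    Setoid (LocalSection m EF π x) where
  r := Contact k
  iseqv :=
    { refl := fun _ => ⟨rfl, fun _ _ => rfl⟩
      symm := fun h => ⟨h.1.symm, fun j hj => (h.2 j hj).symm⟩
      trans := fun h h' => ⟨h.1.trans h'.1, fun j hj => (h.2 j hj).trans (h'.2 j hj)⟩ }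

/-- The `k`-th jet bundle `J^k F` of sections of `π : F → M`, as a set: pairs of a point `x` of `M`
and a class of local sections at `x` modulo contact to order `k`. -/
def JetBundle (m : ℕ) {M : Type*} [TopologicalSpace M] [ChartedSpace (Euc m) M]
    (EF : Type*) [NormedAddCommGroup EF] [NormedSpace ℝ EF]
    {F : Type*} [TopologicalSpace F] [ChartedSpace EF F] (π : F → M) (k : ℕ) : Type _ :=
  Σ x : M, Quotient (contactSetoid m EF π k x)

/-- The `k`-jet at `x` of a local section. -/
def jet (k : ℕ) {π : F → M} {x : M} (s : LocalSection m EF π x) : JetBundle m EF π k :=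
  ⟨x, Quotient.mk (contactSetoid m EF π k x) s⟩

/-- The projection `J^k F → M`. -/
def JetBundle.toBase {π : F → M} {k : ℕ} (z : JetBundle m EF π k) : M := z.1

/-- The projection `J^k F → F`, which maps the jet of `s` at `x` to `s x`. -/
def JetBundle.toTotal {π : F → M} {k : ℕ} (z : JetBundle m EF π k) : F :=
  Quotient.lift (s := contactSetoid m EF π k z.1) (fun s => s.toFun z.1) (fun _ _ h => h.1) z.2

/-! ### Jet coordinates -/

/-- The multi-indices `α = (α_1, …, α_m)` of order `|α| ≤ k`. -/
abbrev MultiIndex (m k : ℕ) : Type := {α : Fin m → Fin (k + 1) // ∑ a, (α a : ℕ) ≤ k}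

/-- The order `|α|`. -/
def MultiIndex.order {m k : ℕ} (α : MultiIndex m k) : ℕ := ∑ a, (α.1 a : ℕ)

/-- The partial derivative `∂^α f` at `p`: the derivative of order `|α|` applied to the list of
vectors in which the first basis vector comes `α_1` times, then the second `α_2` times, etc. -/
def partialDeriv {m k : ℕ} (α : MultiIndex m k) (f : Euc m → ℝ) (p : Euc m) : ℝ :=
  iteratedFDeriv ℝ (∑ a, (α.1 a : ℕ)) f p
    fun j => EuclideanSpace.single (finSigmaFinEquiv.symm j).1 (1 : ℝ)

/-- The bi-weight `(w, |α|)` of the jet coordinate `Y^I_{w;α}`. -/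
def jetWeight {ι : Type*} (wt : ι → ℕ) (m k : ℕ) (A : ι × MultiIndex m k) : ℕ × ℕ :=
  (wt A.1, A.2.order)

/-- The model space of `J^k F`. -/
abbrev JetModel (ι : Type*) (m k : ℕ) : Type _ := Euc m × (ι × MultiIndex m k → ℝ)

/-- `t` is the local trivialization of `J^k F → M` given by the jet coordinates that are induced
by the adapted coordinates `e` on `F` and the local coordinates `φ` on `M`: its fibre coordinates
at the jet of `s` at `x` are the partial derivatives with respect to `φ`, at `x`, of the
fibre coordinates of `s`. -/
structure IsJetTriv {ι : Type*} {π : F → M} {k : ℕ} [TopologicalSpace (JetBundle m EF π k)]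
    (e : Bundle.Trivialization (ι → ℝ) π) (φ : OpenPartialHomeomorph M (Euc m))
    (t : Bundle.Trivialization (ι × MultiIndex m k → ℝ)
      (JetBundle.toBase : JetBundle m EF π k → M)) : Prop where
  baseSet_eq : t.baseSet = e.baseSet ∩ φ.source
  coord : ∀ x ∈ t.baseSet, ∀ s : LocalSection m EF π x, ∀ i α,
    (t (jet k s)).2 (i, α) =
      partialDeriv α (fun p => (e (s.toFun (φ.symm p))).2 i) (φ x)

/-- A manifold structure on the set `J^k F` for which all induced jet coordinates are smooth
coordinates: for all adapted coordinates `e` on `F` and all smooth local coordinates `φ` on `M`,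
there is a smooth local trivialization of `J^k F → M` given by the induced jet coordinates. -/
def JetCoordsSmooth {ι : Type*} [Fintype ι] {π : F → M} {wt : ι → ℕ}
    (𝓕 : FilteredBundle (Euc m) EF π wt) (k : ℕ) [TopologicalSpace (JetBundle m EF π k)]
    [ChartedSpace (JetModel ι m k) (JetBundle m EF π k)] : Prop :=
  ∀ e ∈ 𝓕.atlas, ∀ φ ∈ IsManifold.maximalAtlas 𝓘(ℝ, Euc m) ∞ M,
    ∃ t : Bundle.Trivialization (ι × MultiIndex m k → ℝ) (JetBundle.toBase : JetBundle m EF π k → M),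
      IsJetTriv e φ t ∧ IsSmoothTriv (Euc m) (JetModel ι m k) t

end Jets

/-- Two manifold structures on a set `X` coincide: the identity is smooth in both directions. -/
def SameManifold {H X : Type*} [NormedAddCommGroup H] [NormedSpace ℝ H]
    (t₁ : TopologicalSpace X) (c₁ : ChartedSpace H X)
    (t₂ : TopologicalSpace X) (c₂ : ChartedSpace H X) : Prop :=
  @ContMDiff ℝ _ H _ _ H _ 𝓘(ℝ, H) X t₁ c₁ H _ _ H _ 𝓘(ℝ, H) X t₂ c₂ ∞ id ∧
  @ContMDiff ℝ _ H _ _ H _ 𝓘(ℝ, H) X t₂ c₂ H _ _ H _ 𝓘(ℝ, H) X t₁ c₁ ∞ id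

end FilteredJet

end

/-! The jet coordinates over a point are faithful and unconstrained. Faithful: by the chain rule,
the derivatives up to order `k` of a composite depend only on those of its factors, so contact,
which is defined in the preferred charts, can be tested in any adapted coordinates; symmetry of
higher derivatives then leaves only multi-indices (`contact_iff_jetCoord_eq`). Unconstrained: a
Taylor polynomial has any prescribed derivatives (`exists_jetCoord_eq`).

The heart is the transition law `exists_jetCoord_transition`. If `u` is a section in old coordinates
and `τ` the change of base coordinates, a component of the section in new coordinates is `P(q, u(τ
q))`, with `P` polynomial of weighted degree at most `w_I`. A derivative either falls on a
coefficient or replaces one factor `∂^β u_i ∘ τ` by a combination of factors `∂_e ∂^β u_i ∘ τ` with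
smooth coefficients. It therefore leaves the components occurring in a monomial alone and raises the
total order by at most one; after `|α|` derivatives the bi-weight is at most `(w_I, |α|)`.
`DiffPoly` carries this bookkeeping.

Hence the changes of jet coordinates are smooth and the charts glue (`jetCore`). Two manifold
structures with smooth jet coordinates agree because the identity is the identity in these
coordinates. Being Hausdorff and second countable passes from `M` to the total space through the
trivializations.

The two filtered structures come from one general fact, `exists_isStructureOver`: if the coordinates
of `v`-weight zero are coordinates on an intermediate space `N`, they can be absorbed into the
coefficients, and the others are polynomial fibre coordinates over `N`. First weights never vanish,
so there `N = M`; second weights vanish exactly when `α = 0`, so there `N = F`.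

Positivity of the weights `w_I` is essential: a bound on the weighted degree then leaves finitely
many monomials, so polynomials with smooth coefficients are finite sums of smooth terms, uniformly
in the base point. -/

namespace FilteredJet

open Filter

/-! ### Jets of maps between normed spaces -/

section SameJet

variable {E G H K : Type*} [NormedAddCommGroup E] [NormedSpace ℝ E] [NormedAddCommGroup G]
  [NormedSpace ℝ G] [NormedAddCommGroup H] [NormedSpace ℝ H] [NormedAddCommGroup K]
  [NormedSpace ℝ K]

/-- The maps `f` and `g` have the same derivatives up to order `k` at `p`. -/
def SameJet (k : ℕ) (f g : E → G) (p : E) : Prop :=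
  ∀ j ≤ k, iteratedFDeriv ℝ j f p = iteratedFDeriv ℝ j g p

theorem SameJet.apply_eq {k : ℕ} {f g : E → G} {p : E} (h : SameJet k f g p) : f p = g p := by
  have := congrArg (fun T => T 0) (h 0 (Nat.zero_le _))
  simpa using this

theorem SameJet.congr {k : ℕ} {f g f' g' : E → G} {p : E} (h : SameJet k f g p)
    (hf : f =ᶠ[𝓝 p] f') (hg : g =ᶠ[𝓝 p] g') : SameJet k f' g' p := fun j hj => by
  rw [← (hf.iteratedFDeriv ℝ j).eq_of_nhds, h j hj, (hg.iteratedFDeriv ℝ j).eq_of_nhds]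

/-- In the Faà di Bruno formula the term of order `j` is a sum over ordered partitions of `j`
elements; their number of blocks and their block sizes are at most `j`, so no higher coefficient
enters. -/
theorem taylorComp_congr {q q' : FormalMultilinearSeries ℝ G H} {r r' : FormalMultilinearSeries ℝ E G}
    {j : ℕ} (hq : ∀ i ≤ j, q i = q' i) (hr : ∀ i ≤ j, r i = r' i) :
    q.taylorComp r j = q'.taylorComp r' j := by
  refine Finset.sum_congr rfl fun c _ => ?_
  ext v
  simp only [FormalMultilinearSeries.compAlongOrderedFinpartition_apply]
  rw [hq _ c.length_le]
  congr 1
  ext i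
  simp only [OrderedFinpartition.applyOrderedFinpartition]
  rw [hr _ (c.partSize_le _)]

theorem SameJet.comp_left {k : ℕ} {f g : E → G} {p : E} (h : SameJet k f g p) {Φ : G → H}
    (hΦ : ContDiffAt ℝ ∞ Φ (f p)) (hf : ContDiffAt ℝ ∞ f p) (hg : ContDiffAt ℝ ∞ g p) :
    SameJet k (Φ ∘ f) (Φ ∘ g) p := fun j hj => by
  have e := h.apply_eq
  have hj' : ((j : ℕ) : ℕ∞ω) ≤ (∞ : ℕ∞ω) := by exact_mod_cast le_top
  rw [iteratedFDeriv_comp hΦ hf hj', iteratedFDeriv_comp (e ▸ hΦ) hg hj', e]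
  exact taylorComp_congr (fun _ _ => rfl) fun i hi => h i (hi.trans hj)

theorem SameJet.comp_right {k : ℕ} {f g : G → H} {τ : E → G} {p : E} (h : SameJet k f g (τ p))
    (hτ : ContDiffAt ℝ ∞ τ p) (hf : ContDiffAt ℝ ∞ f (τ p)) (hg : ContDiffAt ℝ ∞ g (τ p)) :
    SameJet k (f ∘ τ) (g ∘ τ) p := fun j hj => by
  have hj' : ((j : ℕ) : ℕ∞ω) ≤ (∞ : ℕ∞ω) := by exact_mod_cast le_top
  rw [iteratedFDeriv_comp hf hτ hj', iteratedFDeriv_comp hg hτ hj']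
  exact taylorComp_congr (fun i hi => h i (hi.trans hj)) fun _ _ => rfl

/-- The inverse of a trivialization needs the base point as well as the fibre coordinates; this
allows the base point to be carried along as a common first component. -/
theorem SameJet.prodMk_left {k : ℕ} {f g : E → G} {p : E} (h : SameJet k f g p) {u : E → H}
    (hu : ContDiffAt ℝ ∞ u p) (hf : ContDiffAt ℝ ∞ f p) (hg : ContDiffAt ℝ ∞ g p) :
    SameJet k (fun q => (u q, f q)) (fun q => (u q, g q)) p := fun j hj => by
  have hj' : ((j : ℕ) : ℕ∞ω) ≤ (∞ : ℕ∞ω) := by exact_mod_cast le_top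
  rw [iteratedFDeriv_prodMk hu hf hj', iteratedFDeriv_prodMk hu hg hj', h j hj]

end SameJet

/-! ### Iterated partial derivatives -/

section PartialDerivatives

variable {m : ℕ}

/-- The function `f` is smooth in a neighbourhood of `p`. -/
def SmoothNear {E G : Type*} [NormedAddCommGroup E] [NormedSpace ℝ E] [NormedAddCommGroup G]
    [NormedSpace ℝ G] (f : E → G) (p : E) : Prop := ∀ᶠ q in 𝓝 p, ContDiffAt ℝ ∞ f q

theorem SmoothNear.self {E G : Type*} [NormedAddCommGroup E] [NormedSpace ℝ E]
    [NormedAddCommGroup G] [NormedSpace ℝ G] {f : E → G} {p : E} (h : SmoothNear f p) :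
    ContDiffAt ℝ ∞ f p := h.self_of_nhds

/-- The iterated partial derivative of `f` in the directions listed in `L`. -/
noncomputable def listDeriv : List (Fin m) → (Euc m → ℝ) → Euc m → ℝ
  | [], f => f
  | a :: L, f => fun p => fderiv ℝ (listDeriv L f) p (EuclideanSpace.single a 1)

theorem contDiffAt_listDeriv (L : List (Fin m)) {f : Euc m → ℝ} {p : Euc m}
    (h : ContDiffAt ℝ ∞ f p) : ContDiffAt ℝ ∞ (listDeriv L f) p := by
  induction L with
  | nil => exact h
  | cons a L ih =>
    have : ContDiffAt ℝ ∞ (fderiv ℝ (listDeriv L f)) p := ih.fderiv_right (by simp)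
    exact this.clm_apply contDiffAt_const

/-- Adjacent transpositions generate, and each is the symmetry of a second derivative. Below a
further derivative the equality is needed in a neighbourhood, which is why smoothness near `p` is
assumed and not only at `p`. -/
theorem listDeriv_perm {L L' : List (Fin m)} (h : L.Perm L') {f : Euc m → ℝ} {p : Euc m}
    (hf : SmoothNear f p) : listDeriv L f p = listDeriv L' f p := by
  induction h generalizing p with
  | nil => rfl
  | cons a _ ih =>
    have : listDeriv _ f =ᶠ[𝓝 p] listDeriv _ f :=
      (eventually_eventually_nhds.2 hf).mono fun q hq => ih hq
    simp only [listDeriv, this.fderiv_eq]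
  | swap a b L =>
    have h2 := contDiffAt_listDeriv L hf.self
    have hd : DifferentiableAt ℝ (fderiv ℝ (listDeriv L f)) p :=
      (h2.fderiv_right (m := ∞) (by simp)).differentiableAt (by simp)
    have hs : IsSymmSndFDerivAt ℝ (listDeriv L f) p := h2.isSymmSndFDerivAt
      (by simpa using (ENat.LEInfty.out : (2 : ℕ∞ω) ≤ ∞))
    simp only [listDeriv]
    rw [fderiv_clm_apply hd (differentiableAt_const _),
      fderiv_clm_apply hd (differentiableAt_const _)]
    simpa using hs _ _
  | trans _ _ ih ih' => rw [ih hf, ih' hf]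

theorem iteratedFDeriv_eq_listDeriv {n : ℕ} (v : Fin n → Fin m) {f : Euc m → ℝ} {p : Euc m}
    (hf : SmoothNear f p) :
    iteratedFDeriv ℝ n f p (fun j => EuclideanSpace.single (v j) 1) =
      listDeriv (List.ofFn v) f p := by
  induction n generalizing p with
  | zero => simp [listDeriv]
  | succ n ih =>
    have hd : DifferentiableAt ℝ (iteratedFDeriv ℝ n f) p :=
      hf.self.differentiableAt_iteratedFDeriv (by exact_mod_cast WithTop.coe_lt_top n)
    rw [hd.iteratedFDeriv_succ_apply_left', List.ofFn_succ]
    simp only [listDeriv]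
    have : (fun q => iteratedFDeriv ℝ n f q
        (Fin.tail fun j => EuclideanSpace.single (v j) (1 : ℝ))) =ᶠ[𝓝 p]
        listDeriv (List.ofFn fun j => v j.succ) f :=
      (eventually_eventually_nhds.2 hf).mono fun q hq => ih (fun j => v j.succ) hq
    rw [this.fderiv_eq]

/-- The multi-index with entries `α_a` as a sorted list of directions. -/
def MultiIndex.toList {k : ℕ} (α : MultiIndex m k) : List (Fin m) :=
  List.ofFn fun j : Fin (∑ a, (α.1 a : ℕ)) => (finSigmaFinEquiv.symm j).1

theorem partialDeriv_eq_listDeriv {k : ℕ} (α : MultiIndex m k) {f : Euc m → ℝ} {p : Euc m}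
    (hf : SmoothNear f p) : partialDeriv α f p = listDeriv α.toList f p :=
  iteratedFDeriv_eq_listDeriv _ hf

theorem MultiIndex.length_toList {k : ℕ} (α : MultiIndex m k) : α.toList.length = α.order := by
  simp [toList, order]

theorem MultiIndex.count_toList {k : ℕ} (α : MultiIndex m k) (a : Fin m) :
    α.toList.count a = α.1 a := by
  classical
  -- The positions that carry the direction `a` are the fibre over `a` of the sigma type flattened
  -- by `finSigmaFinEquiv`, and this fibre is `Fin (α a)`.
  have h : (Finset.univ.filter fun j : Fin (∑ a, (α.1 a : ℕ)) =>
      (finSigmaFinEquiv.symm j).1 = a).card = α.1 a := by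
    rw [← Fintype.card_subtype]
    exact (Fintype.card_congr ((finSigmaFinEquiv.symm.subtypeEquiv fun j => Iff.rfl).trans
      (Equiv.sigmaSubtype a))).trans (Fintype.card_fin _)
  rw [toList, List.ofFn_eq_map, ← Multiset.coe_count, ← Multiset.map_coe, Multiset.count_map, ← h]
  simp only [eq_comm (a := a)]
  rfl

/-- The multi-index which counts the directions in a list. -/
def MultiIndex.ofList {k : ℕ} (L : List (Fin m)) (hL : L.length ≤ k) : MultiIndex m k :=
  ⟨fun a => ⟨L.count a, Nat.lt_succ_of_le (List.count_le_length.trans hL)⟩, by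
    simpa [Multiset.sum_count_eq_card] using
      (Multiset.sum_count_eq_card (s := Finset.univ) (m := (L : Multiset (Fin m)))
        (fun _ _ => Finset.mem_univ _)).trans_le hL⟩

theorem MultiIndex.order_ofList {k : ℕ} (L : List (Fin m)) (hL : L.length ≤ k) :
    (ofList L hL : MultiIndex m k).order = L.length := by
  simpa [order, ofList] using Multiset.sum_count_eq_card (s := Finset.univ)
    (m := (L : Multiset (Fin m))) (fun _ _ => Finset.mem_univ _)

theorem MultiIndex.toList_ofList_perm {k : ℕ} (L : List (Fin m)) (hL : L.length ≤ k) :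
    (ofList L hL : MultiIndex m k).toList.Perm L :=
  List.perm_iff_count.2 fun a => by rw [count_toList]; rfl

theorem listDeriv_eq_partialDeriv {k : ℕ} (L : List (Fin m)) (hL : L.length ≤ k) {f : Euc m → ℝ}
    {p : Euc m} (hf : SmoothNear f p) :
    listDeriv L f p = partialDeriv (MultiIndex.ofList L hL : MultiIndex m k) f p := by
  rw [partialDeriv_eq_listDeriv _ hf, listDeriv_perm (MultiIndex.toList_ofList_perm L hL) hf]

theorem partialDeriv_congr {k : ℕ} (α : MultiIndex m k) {f g : Euc m → ℝ} {p : Euc m}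
    (h : f =ᶠ[𝓝 p] g) : partialDeriv α f p = partialDeriv α g p := by
  rw [partialDeriv, (h.iteratedFDeriv ℝ _).eq_of_nhds, partialDeriv]

/-- A multilinear map is determined by its values on lists of basis vectors. Such a value is an
iterated partial derivative, and reordering the list turns it into one indexed by a multi-index. -/
theorem sameJet_of_partialDeriv_eq {k : ℕ} {ι : Type*} [Fintype ι] {u u' : Euc m → ι → ℝ}
    {p : Euc m} (hu : SmoothNear u p) (hu' : SmoothNear u' p)
    (h : ∀ i, ∀ α : MultiIndex m k,
      partialDeriv α (fun q => u q i) p = partialDeriv α (fun q => u' q i) p) :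
    SameJet k u u' p := fun j hj => by
  have hj' : ((j : ℕ) : ℕ∞ω) ≤ (∞ : ℕ∞ω) := by exact_mod_cast le_top
  have comp : ∀ {v : Euc m → ι → ℝ}, SmoothNear v p → ∀ i, SmoothNear (fun q => v q i) p :=
    fun hv i => hv.mono fun q hq => contDiffAt_pi.1 hq i
  apply ContinuousMultilinearMap.toMultilinearMap_injective
  refine Module.Basis.ext_multilinear (fun _ => (EuclideanSpace.basisFun (Fin m) ℝ).toBasis)
    fun v => ?_
  ext i
  have key : ∀ {v' : Euc m → ι → ℝ}, SmoothNear v' p →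
      iteratedFDeriv ℝ j v' p (fun a => EuclideanSpace.single (v a) 1) i =
        partialDeriv (MultiIndex.ofList (List.ofFn v) (by simpa using hj) : MultiIndex m k)
          (fun q => v' q i) p := fun {v'} hv => by
    have := (ContinuousLinearMap.proj (R := ℝ) (φ := fun _ : ι => ℝ) i).iteratedFDeriv_comp_left
      hv.self hj'
    have := congrArg (fun T => T (fun a => EuclideanSpace.single (v a) 1)) this
    simp only [ContinuousLinearMap.compContinuousMultilinearMap_coe, Function.comp_apply,
      ContinuousLinearMap.proj_apply] at this
    rw [← this, ← listDeriv_eq_partialDeriv _ _ (comp hv i)]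
    exact iteratedFDeriv_eq_listDeriv v (comp hv i)
  simpa using (key hu).trans ((h i _).trans (key hu').symm)

theorem partialDeriv_eq_of_sameJet {k : ℕ} {ι : Type*} [Fintype ι] {u u' : Euc m → ι → ℝ}
    {p : Euc m} (hu : ContDiffAt ℝ ∞ u p) (hu' : ContDiffAt ℝ ∞ u' p) (h : SameJet k u u' p)
    (i : ι) (α : MultiIndex m k) :
    partialDeriv α (fun q => u q i) p = partialDeriv α (fun q => u' q i) p := by
  have := h.comp_left (Φ := ContinuousLinearMap.proj (R := ℝ) (φ := fun _ : ι => ℝ) i)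
    (ContinuousLinearMap.contDiff _).contDiffAt hu hu' _ α.2
  exact congrArg (fun T => T fun j => EuclideanSpace.single (finSigmaFinEquiv.symm j).1 (1 : ℝ)) this

/-! ### Realisation of jets -/

/-- The variables are separated: a derivative in direction `b` only sees the factor of the
coordinate `b`, and raises its order by one. -/
theorem listDeriv_prod (L : List (Fin m)) {g : Fin m → ℝ → ℝ} (hg : ∀ a, ContDiff ℝ ∞ (g a)) :
    listDeriv L (fun q => ∏ a, g a (q a)) =
      fun q => ∏ a, iteratedDeriv (L.count a) (g a) (q a) := by
  induction L with
  | nil => simp [listDeriv]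
  | cons b L ih =>
    ext q
    have hd : ∀ a, HasDerivAt (iteratedDeriv (L.count a) (g a))
        (iteratedDeriv (L.count a + 1) (g a) (q a)) (q a) := fun a => by
      rw [iteratedDeriv_succ]
      exact ((hg a).differentiable_iteratedDeriv _
        (by exact_mod_cast WithTop.coe_lt_top _)).differentiableAt.hasDerivAt
    have hc : ∀ a, HasFDerivAt (fun q : Euc m => iteratedDeriv (L.count a) (g a) (q a))
        (iteratedDeriv (L.count a + 1) (g a) (q a) • (EuclideanSpace.proj a : Euc m →L[ℝ] ℝ)) q :=
      fun a => HasDerivAt.comp_hasFDerivAt (f := fun q : Euc m => q a) q (hd a)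
        (EuclideanSpace.proj a : Euc m →L[ℝ] ℝ).hasFDerivAt
    have := HasFDerivAt.finsetProd (u := Finset.univ) (fun a _ => hc a)
    simp only [listDeriv, ih]
    rw [this.fderiv]
    simp only [sum_apply, smul_apply, PiLp.proj_apply,
      smul_eq_mul]
    rw [Finset.sum_eq_single b]
    · rw [← Finset.mul_prod_erase _ _ (Finset.mem_univ b)]
      simp only [PiLp.single_apply, if_true, mul_one, List.count_cons_self]
      rw [mul_comm]
      congr 1
      refine Finset.prod_congr rfl fun a ha => ?_
      rw [List.count_cons_of_ne (Finset.ne_of_mem_erase ha).symm]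
    · intro a _ ha
      simp [ha]
    · simp

theorem listDeriv_sum (L : List (Fin m)) {A : Type*} (s : Finset A) {f : A → Euc m → ℝ}
    (hf : ∀ i, ContDiff ℝ ∞ (f i)) (c : A → ℝ) :
    listDeriv L (fun q => ∑ i ∈ s, c i * f i q) = fun q => ∑ i ∈ s, c i * listDeriv L (f i) q := by
  induction L with
  | nil => rfl
  | cons b L ih =>
    ext q
    have hd : ∀ i, DifferentiableAt ℝ (listDeriv L (f i)) q := fun i =>
      (contDiffAt_listDeriv L (hf i).contDiffAt).differentiableAt (by simp)
    simp only [listDeriv, ih]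
    rw [fderiv_fun_sum fun i _ => (hd i).const_mul (c i)]
    simp only [sum_apply]
    refine Finset.sum_congr rfl fun i _ => ?_
    rw [fderiv_const_mul (hd i)]
    simp

/-- The polynomial map whose partial derivatives at `p` up to order `k` are `y`. -/
noncomputable def taylorPoly {ι : Type*} {k : ℕ} (p : Euc m) (y : ι × MultiIndex m k → ℝ) (q : Euc m) (i : ι) : ℝ :=
  ∑ α : MultiIndex m k, (y (i, α) / ∏ a, ((α.1 a : ℕ).factorial : ℝ)) *
    ∏ a, (q a - p a) ^ (α.1 a : ℕ)

theorem contDiff_taylorPoly {ι : Type*} [Fintype ι] {k : ℕ} (p : Euc m)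
    (y : ι × MultiIndex m k → ℝ) : ContDiff ℝ ∞ (taylorPoly p y) := by
  unfold taylorPoly
  fun_prop

theorem partialDeriv_taylorPoly {ι : Type*} [Fintype ι] {k : ℕ} (p : Euc m)
    (y : ι × MultiIndex m k → ℝ) (i : ι) (β : MultiIndex m k) :
    partialDeriv β (fun q => taylorPoly p y q i) p = y (i, β) := by
  have hs : ContDiff ℝ ∞ fun q => taylorPoly p y q i := contDiff_pi.1 (contDiff_taylorPoly p y) i
  rw [partialDeriv_eq_listDeriv β (Eventually.of_forall fun q => hs.contDiffAt)]
  have hg : ∀ (α : MultiIndex m k) (a : Fin m),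
      ContDiff ℝ ∞ fun t : ℝ => (t - p a) ^ (α.1 a : ℕ) := fun α a => by fun_prop
  have h1 : ∀ (α : MultiIndex m k), ContDiff ℝ ∞
      fun q : Euc m => ∏ a, (q a - p a) ^ (α.1 a : ℕ) := fun α => by fun_prop
  unfold taylorPoly
  rw [listDeriv_sum _ _ h1]
  -- At the centre `p`, the derivative `∂^β` of `(q - p)^α` is `α!` if `α = β` and zero otherwise,
  -- so one term of the sum survives and the factorials in `taylorPoly` cancel.
  have h2 : ∀ α : MultiIndex m k,
      listDeriv β.toList (fun q : Euc m => ∏ a, (q a - p a) ^ (α.1 a : ℕ)) p =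
        if α = β then ∏ a, ((α.1 a : ℕ).factorial : ℝ) else 0 := fun α => by
    rw [listDeriv_prod β.toList (g := fun a t => (t - p a) ^ (α.1 a : ℕ)) (hg α)]
    have h3 : ∀ a, iteratedDeriv (β.toList.count a) (fun t => (t - p a) ^ (α.1 a : ℕ)) (p a) =
        if (β.1 a : ℕ) = α.1 a then ((α.1 a : ℕ).factorial : ℝ) else 0 := fun a => by
      rw [MultiIndex.count_toList, iteratedDeriv_comp_sub_const (f := fun t => t ^ (α.1 a : ℕ))]
      simp only [sub_self]
      rw [iteratedDeriv_fun_pow_zero]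
      split_ifs with h <;> simp_all
    simp only [h3]
    split_ifs with h
    · subst h; simp
    · obtain ⟨a, ha⟩ : ∃ a, (β.1 a : ℕ) ≠ α.1 a := by
        by_contra! hc
        exact h (Subtype.ext (funext fun a => Fin.ext (hc a).symm))
      exact Finset.prod_eq_zero (Finset.mem_univ a) (if_neg ha)
  simp only [h2, mul_ite, mul_zero, Finset.sum_ite_eq', Finset.mem_univ, if_true]
  have : (∏ a, ((β.1 a : ℕ).factorial : ℝ)) ≠ 0 :=
    Finset.prod_ne_zero_iff.2 fun a _ => by positivity
  field_simp

end PartialDerivatives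

/-! ### Polynomial differential operators -/

section DiffPoly

variable {m : ℕ} {ι : Type*}

/-- Polynomial differential operators `u ↦ f u` from maps `u` near `τ W` to functions on `W`: the
value `f u p` is a polynomial in the partial derivatives of `u` at `τ p`, with coefficients smooth
in `p ∈ W`, of weight at most `a` in the components and of total order at most `b`. -/
inductive DiffPoly (W : Set (Euc m)) (τ : Euc m → Euc m) (w : ι → ℕ) :
    ℕ → ℕ → ((Euc m → ι → ℝ) → Euc m → ℝ) → Prop
  -- The bounds of a coefficient are arbitrary, so the indices are upper bounds rather than degrees,
  -- and terms of different weights can be added.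
  | coeff (c : Euc m → ℝ) (hc : ContDiffOn ℝ ∞ c W) (a b : ℕ) : DiffPoly W τ w a b fun _ p => c p
  | mul_var {a b : ℕ} {f : (Euc m → ι → ℝ) → Euc m → ℝ} (hf : DiffPoly W τ w a b f) (i : ι)
      (L : List (Fin m)) : DiffPoly W τ w (a + w i) (b + L.length)
        fun u p => f u p * listDeriv L (fun q => u q i) (τ p)
  | add {a b : ℕ} {f g : (Euc m → ι → ℝ) → Euc m → ℝ} (hf : DiffPoly W τ w a b f)
      (hg : DiffPoly W τ w a b g) : DiffPoly W τ w a b fun u p => f u p + g u p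

namespace DiffPoly

variable {W : Set (Euc m)} {τ : Euc m → Euc m} {w : ι → ℕ} {a b : ℕ}
  {f : (Euc m → ι → ℝ) → Euc m → ℝ}

theorem coeff_mul (hf : DiffPoly W τ w a b f) {c : Euc m → ℝ} (hc : ContDiffOn ℝ ∞ c W) :
    DiffPoly W τ w a b fun u p => c p * f u p := by
  induction hf with
  | coeff d hd a b => exact coeff (fun p => c p * d p) (hc.mul hd) a b
  | mul_var _ i L ih => simpa only [mul_assoc] using ih.mul_var i L
  | add _ _ ih ih' => simpa only [mul_add] using ih.add ih'

theorem sum {A : Type*} (s : Finset A) {f : A → (Euc m → ι → ℝ) → Euc m → ℝ}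
    (hf : ∀ i ∈ s, DiffPoly W τ w a b (f i)) :
    DiffPoly W τ w a b fun u p => ∑ i ∈ s, f i u p := by
  classical
  induction s using Finset.induction_on with
  | empty => simpa using coeff (fun _ => 0) contDiffOn_const a b
  | insert i s hi ih =>
    simp only [Finset.sum_insert hi]
    exact (hf i (Finset.mem_insert_self _ _)).add
      (ih fun j hj => hf j (Finset.mem_insert_of_mem hj))

theorem mul_pow (hf : DiffPoly W τ w a b f) (i : ι) (n : ℕ) :
    DiffPoly W τ w (a + n * w i) b fun u p => f u p * u (τ p) i ^ n := by
  induction n with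
  | zero => simpa using hf
  | succ n ih => simpa [pow_succ, mul_assoc, add_mul, add_assoc, listDeriv] using ih.mul_var i []

theorem mul_prod_pow (hf : DiffPoly W τ w a b f) (s : Finset ι) (n : ι → ℕ) :
    DiffPoly W τ w (a + ∑ i ∈ s, n i * w i) b fun u p => f u p * ∏ i ∈ s, u (τ p) i ^ n i := by
  classical
  induction s using Finset.induction_on with
  | empty => simpa using hf
  | insert i s hi ih =>
    convert ih.mul_pow i (n i) using 1
    · rw [Finset.sum_insert hi]; ring
    · ext u p; rw [Finset.prod_insert hi]; ring

theorem contDiffAt (hW : IsOpen W) (hτ : ContDiffOn ℝ ∞ τ W) (hf : DiffPoly W τ w a b f)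
    {u : Euc m → ι → ℝ} {p : Euc m} (hp : p ∈ W) (hu : ∀ i, ContDiffAt ℝ ∞ (fun q => u q i) (τ p)) :
    ContDiffAt ℝ ∞ (f u) p := by
  induction hf with
  | coeff c hc => exact hc.contDiffAt (hW.mem_nhds hp)
  | mul_var _ i L ih =>
    exact ih.mul ((contDiffAt_listDeriv L (hu i)).comp p (hτ.contDiffAt (hW.mem_nhds hp)))
  | add _ _ ih ih' => exact ih.add ih'

/-- Product and chain rule: the derivative of `∂_L u_i ∘ τ` in direction `c` is the sum over `e` of
`∂_c τ_e` times `∂_e ∂_L u_i ∘ τ`. The component `i` persists, so `a` is unchanged, while the list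
grows by one entry. -/
theorem exists_fderiv (hW : IsOpen W) (hτ : ContDiffOn ℝ ∞ τ W) (hf : DiffPoly W τ w a b f)
    (c : Fin m) : ∃ g, DiffPoly W τ w a (b + 1) g ∧ ∀ u, ∀ p ∈ W,
      (∀ i, ContDiffAt ℝ ∞ (fun q => u q i) (τ p)) →
        fderiv ℝ (f u) p (EuclideanSpace.single c 1) = g u p := by
  induction hf with
  | coeff d hd a b =>
    refine ⟨_, coeff (fun p => fderiv ℝ d p (EuclideanSpace.single c 1)) ?_ a (b + 1),
      fun _ _ _ _ => rfl⟩
    exact (hd.fderiv_of_isOpen hW (by simp)).clm_apply contDiffOn_const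
  | @mul_var a b f hf i L ih =>
    obtain ⟨g, hg, hfg⟩ := ih
    have hd : ∀ e : Fin m,
        ContDiffOn ℝ ∞ (fun p => fderiv ℝ τ p (EuclideanSpace.single c 1) e) W := fun e => by
      have : ContDiffOn ℝ ∞ (fun p => fderiv ℝ τ p (EuclideanSpace.single c (1 : ℝ))) W :=
        (hτ.fderiv_of_isOpen hW (by simp)).clm_apply contDiffOn_const
      exact (EuclideanSpace.proj e : Euc m →L[ℝ] ℝ).contDiff.comp_contDiffOn this
    refine ⟨fun u p => g u p * listDeriv L (fun q => u q i) (τ p) +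
      ∑ e, fderiv ℝ τ p (EuclideanSpace.single c 1) e *
        (f u p * listDeriv (e :: L) (fun q => u q i) (τ p)), ?_, fun u p hp hu => ?_⟩
    · refine add ?_ (sum _ fun e _ => coeff_mul ?_ (hd e))
      · simpa only [add_right_comm] using hg.mul_var i L
      · simpa only [List.length_cons, add_assoc] using hf.mul_var i (e :: L)
    · have h1 : DifferentiableAt ℝ (f u) p := (hf.contDiffAt hW hτ hp hu).differentiableAt (by simp)
      have h2 : DifferentiableAt ℝ (listDeriv L fun q => u q i) (τ p) :=
        (contDiffAt_listDeriv L (hu i)).differentiableAt (by simp)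
      have h3 : DifferentiableAt ℝ τ p :=
        (hτ.contDiffAt (hW.mem_nhds hp)).differentiableAt (by simp)
      have h4 := h1.hasFDerivAt.mul (h2.hasFDerivAt.comp p h3.hasFDerivAt)
      -- The vector `∂_c τ` is expanded in the standard basis, so that only derivatives along basis
      -- vectors remain.
      have h5 : ∀ v : Euc m, v = ∑ e, v e • EuclideanSpace.single e (1 : ℝ) := fun v => by
        simpa using ((EuclideanSpace.basisFun (Fin m) ℝ).sum_repr v).symm
      rw [HasFDerivAt.fderiv (f := fun p => f u p * listDeriv L (fun q => u q i) (τ p)) h4]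
      simp only [add_apply, smul_apply, ContinuousLinearMap.comp_apply, smul_eq_mul,
        Function.comp_apply]
      rw [hfg u p hp hu]
      conv_lhs => rw [h5 (fderiv ℝ τ p (EuclideanSpace.single c 1))]
      simp only [map_sum, map_smul, smul_eq_mul, Finset.mul_sum, listDeriv]
      rw [add_comm]
      congr 1
      · ring
      · exact Finset.sum_congr rfl fun e _ => by ring
  | add hf hg ih ih' =>
    obtain ⟨g, hg1, hg2⟩ := ih
    obtain ⟨g', hg1', hg2'⟩ := ih'
    refine ⟨_, hg1.add hg1', fun u p hp hu => ?_⟩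
    rw [fderiv_fun_add ((hf.contDiffAt hW hτ hp hu).differentiableAt (by simp))
      ((hg.contDiffAt hW hτ hp hu).differentiableAt (by simp))]
    simp [hg2 u p hp hu, hg2' u p hp hu]

theorem exists_listDeriv [Fintype ι] (hW : IsOpen W) (hτ : ContDiffOn ℝ ∞ τ W)
    (hf : DiffPoly W τ w a b f) (L : List (Fin m)) :
    ∃ g, DiffPoly W τ w a (b + L.length) g ∧ ∀ u, ∀ p ∈ W, SmoothNear u (τ p) →
      listDeriv L (f u) p = g u p := by
  induction L with
  | nil => exact ⟨f, hf, fun _ _ _ _ => rfl⟩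
  | cons c L ih =>
    obtain ⟨g, hg, hfg⟩ := ih
    obtain ⟨g', hg', hgg'⟩ := hg.exists_fderiv hW hτ c
    refine ⟨g', by simpa [add_assoc] using hg', fun u p hp hu => ?_⟩
    -- The identity must hold near `p` before it can be differentiated once more; smoothness of `u`
    -- near `τ p` gives it by continuity of `τ`.
    have hev : listDeriv L (f u) =ᶠ[𝓝 p] g u := by
      have h1 : ∀ᶠ q in 𝓝 p, SmoothNear u (τ q) :=
        (hτ.contDiffAt (hW.mem_nhds hp)).continuousAt.eventually (eventually_eventually_nhds.2 hu)
      filter_upwards [h1, hW.mem_nhds hp] with q h1 h2 using hfg u q h2 h1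
    rw [← hgg' u p hp fun i => contDiffAt_pi.1 hu.self i, ← hev.fderiv_eq]
    rfl

/-- Each list of directions is sorted into a multi-index and becomes a polynomial variable. The
bound `b ≤ k` ensures that every list that occurs is short enough for this. -/
theorem exists_polynomial [Fintype ι] {k : ℕ} (hf : DiffPoly W τ w a b f) (hb : b ≤ k) :
    ∃ P : Euc m → MvPolynomial (ι × MultiIndex m k) ℝ,
      (∀ n, ContDiffOn ℝ ∞ (fun p => (P p).coeff n) W) ∧
      (∀ p n, (P p).coeff n ≠ 0 → Finsupp.weight (fun A => (jetWeight w m k A).1) n ≤ a ∧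
        Finsupp.weight (fun A => (jetWeight w m k A).2) n ≤ b) ∧
      ∀ p ∈ W, ∀ u, SmoothNear u (τ p) → f u p =
        MvPolynomial.eval (fun A => partialDeriv A.2 (fun q => u q A.1) (τ p)) (P p) := by
  classical
  induction hf with
  | coeff c hc a b =>
    refine ⟨fun p => MvPolynomial.C (c p), fun n => ?_, fun p n hn => ?_, fun p _ u _ => by simp⟩
    · simp only [MvPolynomial.coeff_C]
      split_ifs
      · exact hc
      · exact contDiffOn_const
    · rw [MvPolynomial.coeff_C] at hn
      obtain rfl : 0 = n := by by_contra h; exact hn (if_neg h)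
      simp
  | @mul_var a b f _ i L ih =>
    obtain ⟨P, hP, hd, he⟩ := ih (le_trans (Nat.le_add_right _ _) hb)
    have hL : L.length ≤ k := le_trans (Nat.le_add_left _ _) hb
    refine ⟨fun p => P p * MvPolynomial.X (i, MultiIndex.ofList L hL), fun n => ?_,
      fun p n hn => ?_, fun p hp u hu => ?_⟩
    · simp only [MvPolynomial.coeff_mul_X']
      split_ifs
      · exact hP _
      · exact contDiffOn_const
    · rw [MvPolynomial.coeff_mul_X'] at hn
      split_ifs at hn with hs
      · have h := hd p _ hn
        -- The variable just multiplied in divides the monomial, so the weight of `n` is that of the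
        -- quotient plus the weight of this variable.
        have hle : Finsupp.single (i, MultiIndex.ofList L hL) 1 ≤ n :=
          Finsupp.single_le_iff.2 (Nat.one_le_iff_ne_zero.2 (Finsupp.mem_support_iff.1 hs))
        rw [← tsub_add_cancel_of_le hle, map_add, map_add, Finsupp.weight_single,
          Finsupp.weight_single, one_smul, one_smul]
        refine ⟨Nat.add_le_add h.1 le_rfl, Nat.add_le_add h.2 ?_⟩
        simp only [jetWeight]
        rw [MultiIndex.order_ofList]
      · exact absurd rfl hn
    · beta_reduce
      rw [map_mul, MvPolynomial.eval_X, ← he p hp u hu,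
        listDeriv_eq_partialDeriv L hL (hu.mono fun q hq => contDiffAt_pi.1 hq i)]
  | add _ _ ih ih' =>
    obtain ⟨P, hP, hd, he⟩ := ih hb
    obtain ⟨P', hP', hd', he'⟩ := ih' hb
    refine ⟨fun p => P p + P' p, fun n => ?_, fun p n hn => ?_, fun p hp u hu => ?_⟩
    · simpa using (hP n).add (hP' n)
    · by_contra hc
      refine hn ?_
      rw [MvPolynomial.coeff_add, not_not.1 (mt (hd p n) hc), not_not.1 (mt (hd' p n) hc), add_zero]
    · rw [map_add, ← he p hp u hu, ← he' p hp u hu]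

/-- Evaluation of a family of polynomials with smooth coefficients is a differential operator. -/
theorem exists_of_polynomial [Fintype ι] (hw : ∀ i, w i ≠ 0) {P : Euc m → MvPolynomial ι ℝ} {d : ℕ}
    (hP : ∀ n, ContDiffOn ℝ ∞ (fun p => (P p).coeff n) W)
    (hd : ∀ p ∈ W, (P p).weightedTotalDegree w ≤ d) :
    ∃ f, DiffPoly W τ w d 0 f ∧ ∀ p ∈ W, ∀ u : Euc m → ι → ℝ,
      MvPolynomial.eval (u (τ p)) (P p) = f u p := by
  -- Since the weights are positive, the exponents of weight at most `d` form one finite set that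
  -- serves all base points.
  have hS := Finsupp.finite_of_nat_weight_le w hw d
  refine ⟨fun u p => ∑ n ∈ hS.toFinset, (P p).coeff n * ∏ i, u (τ p) i ^ n i,
    sum _ fun n hn => ?_, fun p hp u => ?_⟩
  · have h := (coeff (τ := τ) (w := w) _ (hP n) (d - Finsupp.weight w n) 0).mul_prod_pow
      Finset.univ n
    have h2 : Finsupp.weight w n = ∑ i, n i * w i := by
      rw [Finsupp.weight_apply, Finsupp.sum_fintype _ _ (by simp)]
      rfl
    rwa [← h2, Nat.sub_add_cancel (by simpa using hn)] at h
  · rw [MvPolynomial.eval_eq']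
    refine Finset.sum_subset (fun n hn => ?_) fun n _ hn => ?_
    · simpa using (MvPolynomial.le_weightedTotalDegree w hn).trans (hd p hp)
    · rw [MvPolynomial.notMem_support_iff.1 hn, zero_mul]

end DiffPoly

/-- The partial derivatives of a polynomial expression in the components of `u ∘ τ` are polynomials
in the partial derivatives of `u`, with control of both weights. -/
theorem exists_polynomial_partialDeriv [Fintype ι] {W : Set (Euc m)} (hW : IsOpen W)
    {τ : Euc m → Euc m} (hτ : ContDiffOn ℝ ∞ τ W) {w : ι → ℕ} (hw : ∀ i, w i ≠ 0)
    {P : Euc m → MvPolynomial ι ℝ} {d : ℕ} (hP : ∀ n, ContDiffOn ℝ ∞ (fun p => (P p).coeff n) W)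
    (hd : ∀ p ∈ W, (P p).weightedTotalDegree w ≤ d) {k : ℕ} (α : MultiIndex m k) :
    ∃ Q : Euc m → MvPolynomial (ι × MultiIndex m k) ℝ,
      (∀ n, ContDiffOn ℝ ∞ (fun p => (Q p).coeff n) W) ∧
      (∀ p, (Q p).weightedTotalDegree (fun A => (jetWeight w m k A).1) ≤ d ∧
        (Q p).weightedTotalDegree (fun A => (jetWeight w m k A).2) ≤ α.order) ∧
      ∀ p ∈ W, ∀ u : Euc m → ι → ℝ, SmoothNear u (τ p) →
        partialDeriv α (fun q => MvPolynomial.eval (u (τ q)) (P q)) p =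
          MvPolynomial.eval (fun A => partialDeriv A.2 (fun q => u q A.1) (τ p)) (Q p) := by
  obtain ⟨f, hf, hPf⟩ := DiffPoly.exists_of_polynomial (τ := τ) hw hP hd
  obtain ⟨g, hg, hfg⟩ := hf.exists_listDeriv hW hτ α.toList
  rw [zero_add, MultiIndex.length_toList] at hg
  obtain ⟨Q, hQ, hdeg, he⟩ := hg.exists_polynomial α.2
  refine ⟨Q, hQ, fun p => ⟨Finset.sup_le fun n hn => (hdeg p n (by simpa using hn)).1,
    Finset.sup_le fun n hn => (hdeg p n (by simpa using hn)).2⟩, fun p hp u hu => ?_⟩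
  have h1 : (fun q => MvPolynomial.eval (u (τ q)) (P q)) =ᶠ[𝓝 p] f u := by
    filter_upwards [hW.mem_nhds hp] with q hq using hPf q hq u
  have h2 : SmoothNear (f u) p := by
    have h3 : ∀ᶠ q in 𝓝 p, SmoothNear u (τ q) :=
      (hτ.contDiffAt (hW.mem_nhds hp)).continuousAt.eventually (eventually_eventually_nhds.2 hu)
    filter_upwards [hW.mem_nhds hp, h3] with q hq h3
    exact hf.contDiffAt hW hτ hq fun i => contDiffAt_pi.1 h3.self i
  rw [partialDeriv_congr α h1, partialDeriv_eq_listDeriv α h2, hfg u p hp hu, he p hp u hu]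

end DiffPoly

/-! ### Smooth trivializations -/

section SmoothTriv

variable {EB EE : Type*} [NormedAddCommGroup EB] [NormedSpace ℝ EB]
  [NormedAddCommGroup EE] [NormedSpace ℝ EE]
  {B E : Type*} [TopologicalSpace B] [ChartedSpace EB B] [TopologicalSpace E] [ChartedSpace EE E]
  {κ : Type*} {π : E → B} {e : Bundle.Trivialization (κ → ℝ) π}

theorem symm_mk_snd {z : E} (hz : π z ∈ e.baseSet) :
    e.toOpenPartialHomeomorph.symm (π z, (e z).2) = z := by
  rw [← e.coe_fst' hz]
  exact e.left_inv (e.mem_source.2 hz)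

theorem proj_symm {x : B} (hx : x ∈ e.baseSet) (y : κ → ℝ) :
    π (e.toOpenPartialHomeomorph.symm (x, y)) = x :=
  e.proj_symm_apply (e.mem_target.2 hx)

theorem apply_symm {x : B} (hx : x ∈ e.baseSet) (y : κ → ℝ) :
    e (e.toOpenPartialHomeomorph.symm (x, y)) = (x, y) :=
  e.right_inv (e.mem_target.2 hx)

variable [Fintype κ]

theorem IsSmoothTriv.contMDiffAt (he : IsSmoothTriv EB EE e) {z : E} (hz : π z ∈ e.baseSet) :
    ContMDiffAt 𝓘(ℝ, EE) (𝓘(ℝ, EB).prod 𝓘(ℝ, κ → ℝ)) ∞ e z :=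
  he.1.contMDiffAt (e.open_source.mem_nhds (e.mem_source.2 hz))

theorem IsSmoothTriv.contMDiffAt_snd (he : IsSmoothTriv EB EE e) {z : E} (hz : π z ∈ e.baseSet) :
    ContMDiffAt 𝓘(ℝ, EE) 𝓘(ℝ, κ → ℝ) ∞ (fun z => (e z).2) z :=
  _root_.contMDiffAt_snd.comp z (he.contMDiffAt hz)

theorem IsSmoothTriv.contMDiffAt_symm (he : IsSmoothTriv EB EE e) {z : B × (κ → ℝ)}
    (hz : z.1 ∈ e.baseSet) :
    ContMDiffAt (𝓘(ℝ, EB).prod 𝓘(ℝ, κ → ℝ)) 𝓘(ℝ, EE) ∞ e.toOpenPartialHomeomorph.symm z :=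
  he.2.contMDiffAt (e.open_target.mem_nhds (e.mem_target.2 hz))

theorem IsSmoothTriv.contMDiffAt_proj (he : IsSmoothTriv EB EE e) {z : E} (hz : π z ∈ e.baseSet) :
    ContMDiffAt 𝓘(ℝ, EE) 𝓘(ℝ, EB) ∞ π z := by
  refine (contMDiffAt_fst.comp z (he.contMDiffAt hz)).congr_of_eventuallyEq ?_
  filter_upwards [e.open_source.mem_nhds (e.mem_source.2 hz)] with z' hz' using
    (e.proj_toFun z' hz').symm

end SmoothTriv

/-! ### Coordinates of sections -/

section SecCoord

theorem eventually_symm {m : ℕ} {M : Type*} [TopologicalSpace M]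
    {φ : OpenPartialHomeomorph M (Euc m)} {x : M} {P : M → Prop} (h : ∀ᶠ y in 𝓝 x, P y) (hx : x ∈ φ.source) :
    ∀ᶠ p in 𝓝 (φ x), p ∈ φ.target ∧ P (φ.symm p) := by
  have h1 := φ.continuousAt_symm (φ.map_source hx)
  rw [ContinuousAt, φ.left_inv hx] at h1
  exact (φ.open_target.eventually_mem (φ.map_source hx)).and (h1.eventually h)

variable {m : ℕ} {M : Type*} [TopologicalSpace M] [ChartedSpace (Euc m) M]
  {EF : Type*} [NormedAddCommGroup EF] [NormedSpace ℝ EF]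
  {F : Type*} [TopologicalSpace F] [ChartedSpace EF F]
  {ι : Type*} {π : F → M} {k : ℕ}
  {e e' : Bundle.Trivialization (ι → ℝ) π} {φ φ' : OpenPartialHomeomorph M (Euc m)} {x : M}

/-- The expression of the section `s` in the coordinates `e` and `φ`. -/
def secCoord (e : Bundle.Trivialization (ι → ℝ) π) (φ : OpenPartialHomeomorph M (Euc m)) (s : M → F)
    (p : Euc m) : ι → ℝ := (e (s (φ.symm p))).2

/-- The jet coordinates of the section `s` at the point `x`. -/
noncomputable def jetCoord (k : ℕ) (e : Bundle.Trivialization (ι → ℝ) π)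
    (φ : OpenPartialHomeomorph M (Euc m)) (s : M → F) (x : M) (A : ι × MultiIndex m k) : ℝ :=
  partialDeriv A.2 (fun p => secCoord e φ s p A.1) (φ x)

theorem LocalSection.eventually_mem (s : LocalSection m EF π x) (hx : x ∈ e.baseSet) :
    ∀ᶠ y in 𝓝 x, y ∈ e.baseSet ∧ π (s.toFun y) = y ∧
      ContMDiffAt 𝓘(ℝ, Euc m) 𝓘(ℝ, EF) ∞ s.toFun y :=
  (e.open_baseSet.eventually_mem hx).and (s.isSection.and s.smooth)

theorem LocalSection.proj_self (s : LocalSection m EF π x) : π (s.toFun x) = x :=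
  s.isSection.self_of_nhds

theorem contMDiffAt_chart (hφ : φ ∈ IsManifold.maximalAtlas 𝓘(ℝ, Euc m) ∞ M) (hx : x ∈ φ.source) :
    ContMDiffAt 𝓘(ℝ, Euc m) 𝓘(ℝ, Euc m) ∞ φ x :=
  (contMDiffOn_of_mem_maximalAtlas hφ).contMDiffAt (φ.open_source.mem_nhds hx)

theorem contMDiffAt_chart_symm (hφ : φ ∈ IsManifold.maximalAtlas 𝓘(ℝ, Euc m) ∞ M) {p : Euc m}
    (hp : p ∈ φ.target) : ContMDiffAt 𝓘(ℝ, Euc m) 𝓘(ℝ, Euc m) ∞ φ.symm p :=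
  (contMDiffOn_symm_of_mem_maximalAtlas hφ).contMDiffAt (φ.open_target.mem_nhds hp)

theorem smoothNear_secCoord [Fintype ι] (he : IsSmoothTriv (Euc m) EF e)
    (hφ : φ ∈ IsManifold.maximalAtlas 𝓘(ℝ, Euc m) ∞ M) (hx : x ∈ e.baseSet) (hx' : x ∈ φ.source)
    (s : LocalSection m EF π x) : SmoothNear (secCoord e φ s.toFun) (φ x) := by
  filter_upwards [eventually_symm (s.eventually_mem hx) hx'] with p hp
  obtain ⟨hp, hb, hπ, hs⟩ := hp
  rw [← contMDiffAt_iff_contDiffAt]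
  have h1 : ContMDiffAt 𝓘(ℝ, EF) 𝓘(ℝ, ι → ℝ) ∞ (fun z => (e z).2) (s.toFun (φ.symm p)) :=
    he.contMDiffAt_snd (by rwa [hπ])
  have h2 : ContMDiffAt 𝓘(ℝ, Euc m) 𝓘(ℝ, EF) ∞ (s.toFun ∘ φ.symm) p :=
    hs.comp p (contMDiffAt_chart_symm hφ hp)
  exact ContMDiffAt.comp (g := fun z => (e z).2) (f := s.toFun ∘ φ.symm) p h1 h2

/-- `Contact` writes each section in the chart at its own value; equality of the values makes these
the same chart, and then the condition is about two maps between fixed normed spaces. -/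
theorem contact_iff_sameJet (s s' : LocalSection m EF π x) : Contact k s s' ↔
    s.toFun x = s'.toFun x ∧
    SameJet k (chartAt EF (s.toFun x) ∘ s.toFun ∘ (chartAt (Euc m) x).symm)
      (chartAt EF (s.toFun x) ∘ s'.toFun ∘ (chartAt (Euc m) x).symm) (chartAt (Euc m) x x) := by
  have h : ∀ f : M → F, writtenInExtChartAt 𝓘(ℝ, Euc m) 𝓘(ℝ, EF) x f =
      chartAt EF (f x) ∘ f ∘ (chartAt (Euc m) x).symm := fun f => by
    ext; simp [writtenInExtChartAt, extChartAt]
  have h' : extChartAt 𝓘(ℝ, Euc m) x x = chartAt (Euc m) x x := by simp [extChartAt]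
  unfold Contact
  refine and_congr_right fun hx => ?_
  simp only [h, h', ← hx, SameJet]

theorem contDiffAt_comp_symm_charts {φ₁ φ₂ : OpenPartialHomeomorph M (Euc m)}
    (h₁ : φ₁ ∈ IsManifold.maximalAtlas 𝓘(ℝ, Euc m) ∞ M)
    (h₂ : φ₂ ∈ IsManifold.maximalAtlas 𝓘(ℝ, Euc m) ∞ M) {p : Euc m} (hp : p ∈ φ₁.target)
    (hp' : φ₁.symm p ∈ φ₂.source) : ContDiffAt ℝ ∞ (φ₂ ∘ φ₁.symm) p :=
  contMDiffAt_iff_contDiffAt.1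
    ((contMDiffAt_chart h₂ hp').comp p (contMDiffAt_chart_symm h₁ hp))

section

variable [Fintype ι]

/-- There are local sections with arbitrary jet coordinates. -/
theorem exists_jetCoord_eq (he : IsSmoothTriv (Euc m) EF e)
    (hφ : φ ∈ IsManifold.maximalAtlas 𝓘(ℝ, Euc m) ∞ M) (hx : x ∈ e.baseSet) (hx' : x ∈ φ.source)
    (y : ι × MultiIndex m k → ℝ) :
    ∃ s : LocalSection m EF π x, jetCoord k e φ s.toFun x = y := by
  have hev : ∀ᶠ x' in 𝓝 x, x' ∈ e.baseSet ∧ x' ∈ φ.source :=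
    (e.open_baseSet.eventually_mem hx).and (φ.open_source.eventually_mem hx')
  let s : LocalSection m EF π x :=
    { toFun := fun x' => e.toOpenPartialHomeomorph.symm (x', taylorPoly (φ x) y (φ x'))
      isSection := hev.mono fun x' h => proj_symm h.1 _
      smooth := hev.mono fun x' h => by
        have h1 : ContMDiffAt 𝓘(ℝ, Euc m) 𝓘(ℝ, ι → ℝ) ∞ (fun x' => taylorPoly (φ x) y (φ x')) x' :=
          (contDiff_taylorPoly (φ x) y).contDiffAt.contMDiffAt.comp x' (contMDiffAt_chart hφ h.2)
        exact (he.contMDiffAt_symm (z := (x', taylorPoly (φ x) y (φ x'))) h.1).comp x'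
          (contMDiffAt_id.prodMk h1) }
  refine ⟨s, funext fun A => ?_⟩
  have h2 : (fun p => secCoord e φ s.toFun p A.1) =ᶠ[𝓝 (φ x)]
      fun p => taylorPoly (φ x) y p A.1 := by
    filter_upwards [eventually_symm hev hx'] with p hp
    simp only [secCoord, s]
    rw [apply_symm hp.2.1, φ.right_inv hp.1]
  rw [jetCoord, partialDeriv_congr _ h2, partialDeriv_taylorPoly]

/-- Under a change of coordinates, the jet coordinates transform polynomially. -/
theorem exists_jetCoord_transition {w : ι → ℕ} (𝓕 : FilteredBundle (Euc m) EF π w)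
    (he : e ∈ 𝓕.atlas) (he' : e' ∈ 𝓕.atlas)
    (hφ : φ ∈ IsManifold.maximalAtlas 𝓘(ℝ, Euc m) ∞ M)
    (hφ' : φ' ∈ IsManifold.maximalAtlas 𝓘(ℝ, Euc m) ∞ M) (A : ι × MultiIndex m k) :
    ∃ Q : Euc m → MvPolynomial (ι × MultiIndex m k) ℝ,
      (∀ n, ContDiffOn ℝ ∞ (fun p => (Q p).coeff n) (φ'.target ∩ φ'.symm ⁻¹'
        (e.baseSet ∩ φ.source ∩ e'.baseSet))) ∧
      (∀ p, (Q p).weightedTotalDegree (fun A => (jetWeight w m k A).1) ≤ (jetWeight w m k A).1 ∧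
        (Q p).weightedTotalDegree (fun A => (jetWeight w m k A).2) ≤ (jetWeight w m k A).2) ∧
      ∀ x ∈ e.baseSet ∩ φ.source, x ∈ e'.baseSet ∩ φ'.source → ∀ s : LocalSection m EF π x,
        jetCoord k e' φ' s.toFun x A = MvPolynomial.eval (jetCoord k e φ s.toFun x) (Q (φ' x)) := by
  obtain ⟨i, α⟩ := A
  obtain ⟨P, hP, hPe⟩ := 𝓕.transition e he e' he' i
  set W := φ'.target ∩ φ'.symm ⁻¹' (e.baseSet ∩ φ.source ∩ e'.baseSet) with hWdef
  have hW : IsOpen W := φ'.isOpen_inter_preimage_symm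
    ((e.open_baseSet.inter φ.open_source).inter e'.open_baseSet)
  have hτ : ContDiffOn ℝ ∞ (φ ∘ φ'.symm) W := fun p hp =>
    (contDiffAt_comp_symm_charts hφ' hφ hp.1 hp.2.1.2).contDiffWithinAt
  have hPc : ∀ n, ContDiffOn ℝ ∞ (fun p => (P (φ'.symm p)).coeff n) W := fun n p hp => by
    have h1 := (hP n).contMDiffAt ((e.open_baseSet.inter e'.open_baseSet).mem_nhds
      (⟨hp.2.1.1, hp.2.2⟩ : φ'.symm p ∈ e.baseSet ∩ e'.baseSet))
    exact (contMDiffAt_iff_contDiffAt.1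
      (h1.comp p (contMDiffAt_chart_symm hφ' hp.1))).contDiffWithinAt
  obtain ⟨Q, hQ, hdeg, hev⟩ := exists_polynomial_partialDeriv hW hτ 𝓕.wt_ne_zero hPc
    (fun p hp => (hPe (φ'.symm p) ⟨hp.2.1.1, hp.2.2⟩).1) α
  refine ⟨Q, hQ, hdeg, fun x hx hx' s => ?_⟩
  have hτx : (φ ∘ φ'.symm) (φ' x) = φ x := congrArg φ (φ'.left_inv hx'.2)
  have hxW : φ' x ∈ W := ⟨φ'.map_source hx'.2, by
    rw [Set.mem_preimage, φ'.left_inv hx'.2]; exact ⟨hx, hx'.1⟩⟩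
  have hu := smoothNear_secCoord (𝓕.smooth e he) hφ hx.1 hx.2 s
  rw [← hτx] at hu
  have h3 := hev (φ' x) hxW _ hu
  rw [hτx] at h3
  -- It remains to see that near `φ' x` the new expression of the section is the transition
  -- polynomial evaluated at the old expression composed with `φ ∘ φ'.symm`.
  refine Eq.trans (partialDeriv_congr α ?_) h3
  filter_upwards [eventually_symm (((s.eventually_mem hx.1).and (φ.open_source.mem_nhds hx.2)).and
    (e'.open_baseSet.mem_nhds hx'.1)) hx'.2] with q hq
  obtain ⟨hq, ⟨⟨hb, hπ, -⟩, hqs⟩, hb'⟩ := hq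
  simp only [secCoord, Function.comp_apply]
  rw [φ.left_inv hqs, ← (hPe (φ'.symm q) ⟨hb, hb'⟩).2]
  have h4 := symm_mk_snd (e := e) (z := s.toFun (φ'.symm q)) (by rwa [hπ])
  rw [hπ] at h4
  rw [h4]

end

variable [IsManifold 𝓘(ℝ, Euc m) ∞ M] [IsManifold 𝓘(ℝ, EF) ∞ F]

theorem chart_comp_contDiffAt (s : LocalSection m EF π x) :
    ContDiffAt ℝ ∞ (chartAt EF (s.toFun x) ∘ s.toFun ∘ (chartAt (Euc m) x).symm)
      (chartAt (Euc m) x x) := by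
  rw [← contMDiffAt_iff_contDiffAt]
  have h0 : (chartAt (Euc m) x).symm (chartAt (Euc m) x x) = x :=
    (chartAt (Euc m) x).left_inv (mem_chart_source _ x)
  have h1 : ContMDiffAt 𝓘(ℝ, EF) 𝓘(ℝ, EF) ∞ (chartAt EF (s.toFun x))
      (s.toFun ((chartAt (Euc m) x).symm (chartAt (Euc m) x x))) := by
    rw [h0]
    exact (contMDiffOn_chart (x := s.toFun x)).contMDiffAt
      ((chartAt EF (s.toFun x)).open_source.mem_nhds (mem_chart_source _ _))
  have h2 : ContMDiffAt 𝓘(ℝ, Euc m) 𝓘(ℝ, EF) ∞ s.toFun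
      ((chartAt (Euc m) x).symm (chartAt (Euc m) x x)) := by
    rw [h0]; exact s.smooth.self_of_nhds
  have h3 : ContMDiffAt 𝓘(ℝ, Euc m) 𝓘(ℝ, EF) ∞ (s.toFun ∘ (chartAt (Euc m) x).symm)
      (chartAt (Euc m) x x) :=
    h2.comp _ (contMDiffAt_chart_symm (IsManifold.chart_mem_maximalAtlas x) (mem_chart_target _ x))
  exact ContMDiffAt.comp (f := s.toFun ∘ (chartAt (Euc m) x).symm) _ h1 h3

variable [Fintype ι]

/-- The expression in `e` and `φ` arises from the one in the preferred charts by composing with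
fixed smooth maps on both sides: the fibre coordinates read in the chart of `F`, and the change of
base coordinates. -/
theorem sameJet_secCoord_of_contact (he : IsSmoothTriv (Euc m) EF e)
    (hφ : φ ∈ IsManifold.maximalAtlas 𝓘(ℝ, Euc m) ∞ M) (hx : x ∈ e.baseSet) (hx' : x ∈ φ.source)
    {s s' : LocalSection m EF π x} (h : Contact k s s') :
    SameJet k (secCoord e φ s.toFun) (secCoord e φ s'.toFun) (φ x) := by
  rw [contact_iff_sameJet] at h
  obtain ⟨h0, h⟩ := h
  set ψ := chartAt EF (s.toFun x) with hψ
  set c := chartAt (Euc m) x with hc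
  have hxc : x ∈ c.source := mem_chart_source _ x
  have hcx : c.symm (c x) = x := c.left_inv hxc
  have hsψ : s.toFun x ∈ ψ.source := mem_chart_source _ _
  have hcm : c ∈ IsManifold.maximalAtlas 𝓘(ℝ, Euc m) ∞ M := IsManifold.chart_mem_maximalAtlas x
  have hd := chart_comp_contDiffAt s
  have hd' := chart_comp_contDiffAt s'
  rw [← h0] at hd'
  rw [← hψ, ← hc] at hd hd'
  have hΦ : ContDiffAt ℝ ∞ (fun v => (e (ψ.symm v)).2) (ψ (s.toFun x)) := by
    rw [← contMDiffAt_iff_contDiffAt]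
    have h1 : ContMDiffAt 𝓘(ℝ, EF) 𝓘(ℝ, ι → ℝ) ∞ (fun z => (e z).2) (ψ.symm (ψ (s.toFun x))) :=
      he.contMDiffAt_snd (by rwa [ψ.left_inv hsψ, s.proj_self])
    exact h1.comp _ ((contMDiffOn_chart_symm (x := s.toFun x)).contMDiffAt
      (ψ.open_target.mem_nhds (ψ.map_source hsψ)))
  have hρ : ContDiffAt ℝ ∞ (c ∘ φ.symm) (φ x) :=
    contDiffAt_comp_symm_charts hφ hcm (φ.map_source hx') (by rwa [φ.left_inv hx'])
  have hρx : (c ∘ φ.symm) (φ x) = c x := congrArg c (φ.left_inv hx')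
  have key := (h.comp_left (Φ := fun v => (e (ψ.symm v)).2)
    (by simpa only [Function.comp_apply, hcx] using hΦ) hd hd')
  rw [← hρx] at key hd hd'
  have hΦ1 : ContDiffAt ℝ ∞ (fun v => (e (ψ.symm v)).2)
      ((ψ ∘ s.toFun ∘ c.symm) ((c ∘ φ.symm) (φ x))) := by
    simpa only [Function.comp_apply, φ.left_inv hx', hcx] using hΦ
  have hΦ2 : ContDiffAt ℝ ∞ (fun v => (e (ψ.symm v)).2)
      ((ψ ∘ s'.toFun ∘ c.symm) ((c ∘ φ.symm) (φ x))) := by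
    simpa only [Function.comp_apply, φ.left_inv hx', hcx, h0] using hΦ
  have key := key.comp_right hρ (hΦ1.comp _ hd) (hΦ2.comp _ hd')
  have hev : ∀ t : LocalSection m EF π x, t.toFun x = s.toFun x →
      (((fun v => (e (ψ.symm v)).2) ∘ (ψ ∘ t.toFun ∘ c.symm)) ∘ (c ∘ φ.symm)) =ᶠ[𝓝 (φ x)]
        secCoord e φ t.toFun := fun t ht => by
    have h1 : ∀ᶠ y in 𝓝 x, t.toFun y ∈ ψ.source ∧ y ∈ c.source :=
      (t.smooth.self_of_nhds.continuousAt.eventually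
        (ψ.open_source.mem_nhds (by rwa [ht]))).and (c.open_source.mem_nhds hxc)
    filter_upwards [eventually_symm h1 hx'] with p hp
    simp only [Function.comp_apply, secCoord]
    rw [c.left_inv hp.2.2, ψ.left_inv hp.2.1]
  exact key.congr (hev s rfl) (hev s' h0.symm)

/-- Conversely, the expression in the preferred charts is a fixed smooth map applied to the pair of
base point and fibre coordinates, precomposed with a change of base coordinates. -/
theorem contact_of_sameJet_secCoord (he : IsSmoothTriv (Euc m) EF e)
    (hφ : φ ∈ IsManifold.maximalAtlas 𝓘(ℝ, Euc m) ∞ M) (hx : x ∈ e.baseSet) (hx' : x ∈ φ.source)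
    {s s' : LocalSection m EF π x}
    (h : SameJet k (secCoord e φ s.toFun) (secCoord e φ s'.toFun) (φ x)) : Contact k s s' := by
  have hval : ∀ t : LocalSection m EF π x, t.toFun x =
      e.toOpenPartialHomeomorph.symm (x, secCoord e φ t.toFun (φ x)) := fun t => by
    have h1 := symm_mk_snd (e := e) (z := t.toFun x) (by rwa [t.proj_self])
    rw [t.proj_self] at h1
    rw [secCoord, φ.left_inv hx', h1]
  have h0 : s.toFun x = s'.toFun x := by rw [hval s, hval s', h.apply_eq]
  rw [contact_iff_sameJet]
  refine ⟨h0, ?_⟩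
  set ψ := chartAt EF (s.toFun x) with hψ
  set c := chartAt (Euc m) x with hc
  have hxc : x ∈ c.source := mem_chart_source _ x
  have hcx : c.symm (c x) = x := c.left_inv hxc
  have hsψ : s.toFun x ∈ ψ.source := mem_chart_source _ _
  have hcm : c ∈ IsManifold.maximalAtlas 𝓘(ℝ, Euc m) ∞ M := IsManifold.chart_mem_maximalAtlas x
  have hu := (smoothNear_secCoord he hφ hx hx' s).self
  have hu' := (smoothNear_secCoord he hφ hx hx' s').self
  have hΦ : ContDiffAt ℝ ∞ (fun v : Euc m × (ι → ℝ) =>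
      ψ (e.toOpenPartialHomeomorph.symm (φ.symm v.1, v.2)))
      (φ x, secCoord e φ s.toFun (φ x)) := by
    rw [← contMDiffAt_iff_contDiffAt]
    have h1 : ContMDiffAt 𝓘(ℝ, Euc m × (ι → ℝ)) (𝓘(ℝ, Euc m).prod 𝓘(ℝ, ι → ℝ)) ∞
        (fun v : Euc m × (ι → ℝ) => (φ.symm v.1, v.2)) (φ x, secCoord e φ s.toFun (φ x)) :=
      ((contMDiffAt_chart_symm hφ (φ.map_source hx')).comp
        (φ x, secCoord e φ s.toFun (φ x)) contDiffAt_fst.contMDiffAt).prodMk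
        contDiffAt_snd.contMDiffAt
    have h2 := he.contMDiffAt_symm (z := (φ.symm (φ x), secCoord e φ s.toFun (φ x)))
      (by simpa only [φ.left_inv hx'] using hx)
    have h3 : ContMDiffAt 𝓘(ℝ, EF) 𝓘(ℝ, EF) ∞ ψ (e.toOpenPartialHomeomorph.symm
        (φ.symm (φ x), secCoord e φ s.toFun (φ x))) := by
      rw [φ.left_inv hx', ← hval s]
      exact (contMDiffOn_chart (x := s.toFun x)).contMDiffAt (ψ.open_source.mem_nhds hsψ)
    have h4 : ContMDiffAt 𝓘(ℝ, Euc m × (ι → ℝ)) 𝓘(ℝ, EF) ∞ (fun v : Euc m × (ι → ℝ) =>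
        e.toOpenPartialHomeomorph.symm (φ.symm v.1, v.2)) (φ x, secCoord e φ s.toFun (φ x)) :=
      ContMDiffAt.comp (g := e.toOpenPartialHomeomorph.symm)
        (f := fun v : Euc m × (ι → ℝ) => (φ.symm v.1, v.2)) _ h2 h1
    exact ContMDiffAt.comp (g := ψ) (f := fun v : Euc m × (ι → ℝ) =>
        e.toOpenPartialHomeomorph.symm (φ.symm v.1, v.2)) _ h3 h4
  have hρ : ContDiffAt ℝ ∞ (φ ∘ c.symm) (c x) :=
    contDiffAt_comp_symm_charts hcm hφ (c.map_source hxc) (by rwa [hcx])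
  have hρx : (φ ∘ c.symm) (c x) = φ x := congrArg φ hcx
  have key := (h.prodMk_left contDiffAt_id hu hu').comp_left hΦ
    (contDiffAt_id.prodMk hu) (contDiffAt_id.prodMk hu')
  rw [← hρx] at key hu hu' hΦ
  have hΦ' := hΦ
  rw [hρx, h.apply_eq, ← hρx] at hΦ'
  have key := key.comp_right hρ
    (ContDiffAt.comp (φ.toFun' (c.symm (c x))) hΦ (contDiffAt_id.prodMk hu))
    (ContDiffAt.comp (φ.toFun' (c.symm (c x))) hΦ' (contDiffAt_id.prodMk hu'))
  have hev : ∀ t : LocalSection m EF π x,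
      (((fun v : Euc m × (ι → ℝ) => ψ (e.toOpenPartialHomeomorph.symm (φ.symm v.1, v.2))) ∘
        (fun q => (id q, secCoord e φ t.toFun q))) ∘ (φ ∘ c.symm)) =ᶠ[𝓝 (c x)]
        (ψ ∘ t.toFun ∘ c.symm) := fun t => by
    have h1 := (t.eventually_mem hx).and (φ.open_source.eventually_mem hx')
    filter_upwards [eventually_symm h1 hxc] with p hp
    obtain ⟨hp, ⟨hb, hπ, -⟩, hps⟩ := hp
    simp only [Function.comp_apply, secCoord, id]
    have h2 := symm_mk_snd (e := e) (z := t.toFun (c.symm p)) (by rwa [hπ])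
    rw [hπ] at h2
    rw [φ.left_inv hps, h2]
  exact key.congr (hev s) (hev s')

/-- Two sections are in contact to order `k` if and only if their jet coordinates coincide. -/
theorem contact_iff_jetCoord_eq (he : IsSmoothTriv (Euc m) EF e)
    (hφ : φ ∈ IsManifold.maximalAtlas 𝓘(ℝ, Euc m) ∞ M) (hx : x ∈ e.baseSet) (hx' : x ∈ φ.source)
    {s s' : LocalSection m EF π x} :
    Contact k s s' ↔ jetCoord k e φ s.toFun x = jetCoord k e φ s'.toFun x := by
  have hu := smoothNear_secCoord he hφ hx hx' s
  have hu' := smoothNear_secCoord he hφ hx hx' s'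
  refine ⟨fun h => funext fun A => ?_, fun h => ?_⟩
  · exact partialDeriv_eq_of_sameJet hu.self hu'.self
      (sameJet_secCoord_of_contact he hφ hx hx' h) A.1 A.2
  · exact contact_of_sameJet_secCoord he hφ hx hx'
      (sameJet_of_partialDeriv_eq hu hu' fun i α => congrFun h (i, α))

end SecCoord

/-! ### The manifold structure of the jet bundle -/

/-- The degree bound with positive weights makes the evaluation a sum over a fixed finite set of
monomials; smoothness of the single coefficients then gives joint smoothness. -/
theorem contDiffOn_eval {X : Type*} [NormedAddCommGroup X] [NormedSpace ℝ X] {κ : Type*} [Fintype κ]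
    {wt : κ → ℕ} (hwt : ∀ A, wt A ≠ 0) {d : ℕ} {W : Set X} {Q : X → MvPolynomial κ ℝ}
    (hQ : ∀ n, ContDiffOn ℝ ∞ (fun p => (Q p).coeff n) W)
    (hd : ∀ p ∈ W, (Q p).weightedTotalDegree wt ≤ d) :
    ContDiffOn ℝ ∞ (fun v : X × (κ → ℝ) => MvPolynomial.eval v.2 (Q v.1)) (W ×ˢ Set.univ) := by
  have hS := Finsupp.finite_of_nat_weight_le wt hwt d
  have h : ContDiffOn ℝ ∞ (fun v : X × (κ → ℝ) => ∑ n ∈ hS.toFinset, (Q v.1).coeff n *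
      ∏ A, v.2 A ^ n A) (W ×ˢ Set.univ) := by
    refine ContDiffOn.sum fun n _ => ContDiffOn.mul ?_ ?_
    · exact (hQ n).comp contDiffOn_fst fun v hv => hv.1
    · exact ContDiff.contDiffOn (by fun_prop)
  refine h.congr fun v hv => ?_
  rw [MvPolynomial.eval_eq']
  refine Finset.sum_subset (fun n hn => ?_) fun n _ hn => ?_
  · simpa using (MvPolynomial.le_weightedTotalDegree wt hn).trans (hd v.1 hv.1)
  · rw [MvPolynomial.notMem_support_iff.1 hn, zero_mul]

section JetManifold

variable {m : ℕ} {M : Type*} [TopologicalSpace M] [ChartedSpace (Euc m) M]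
  {EF : Type*} [NormedAddCommGroup EF] [NormedSpace ℝ EF]
  {F : Type*} [TopologicalSpace F] [ChartedSpace EF F]
  {ι : Type*} {π : F → M} {w : ι → ℕ} {k : ℕ}
  {e e' : Bundle.Trivialization (ι → ℝ) π} {φ φ' : OpenPartialHomeomorph M (Euc m)}

theorem JetBundle.exists_eq_jet (z : JetBundle m EF π k) :
    ∃ s : LocalSection m EF π z.toBase, z = jet k s := by
  obtain ⟨x, q⟩ := z
  obtain ⟨s, rfl⟩ := Quotient.exists_rep q
  exact ⟨s, rfl⟩

/-- The jet coordinates as functions on the jet bundle. -/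
noncomputable def JetBundle.coord (e : Bundle.Trivialization (ι → ℝ) π)
    (φ : OpenPartialHomeomorph M (Euc m)) (z : JetBundle m EF π k) : ι × MultiIndex m k → ℝ :=
  jetCoord k e φ z.2.out.toFun z.1

variable [IsManifold 𝓘(ℝ, Euc m) ∞ M] [Fintype ι]

/-- Supplies the default jet for points outside a coordinate domain, which makes the inverse of a
jet chart a total function. -/
theorem nonempty_localSection (𝓕 : FilteredBundle (Euc m) EF π w) (x : M) :
    Nonempty (LocalSection m EF π x) := by
  obtain ⟨e, he, hx⟩ := 𝓕.cover x
  obtain ⟨s, -⟩ := exists_jetCoord_eq (k := 0) (𝓕.smooth e he)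
    (IsManifold.chart_mem_maximalAtlas x) hx (mem_chart_source (Euc m) x) 0
  exact ⟨s⟩

variable [IsManifold 𝓘(ℝ, EF) ∞ F]

/-- `JetBundle.coord` uses a chosen representative; sections in contact have equal jet coordinates,
so any other representative serves as well. -/
theorem JetBundle.coord_jet (he : IsSmoothTriv (Euc m) EF e)
    (hφ : φ ∈ IsManifold.maximalAtlas 𝓘(ℝ, Euc m) ∞ M) {x : M} (hx : x ∈ e.baseSet ∩ φ.source)
    (s : LocalSection m EF π x) : (jet k s).coord e φ = jetCoord k e φ s.toFun x :=
  (contact_iff_jetCoord_eq he hφ hx.1 hx.2).1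
    (Quotient.mk_out (s := contactSetoid m EF π k x) s)

theorem JetBundle.ext_coord (he : IsSmoothTriv (Euc m) EF e)
    (hφ : φ ∈ IsManifold.maximalAtlas 𝓘(ℝ, Euc m) ∞ M) {z z' : JetBundle m EF π k}
    (hz : z.toBase ∈ e.baseSet ∩ φ.source) (hb : z.toBase = z'.toBase)
    (hc : z.coord e φ = z'.coord e φ) : z = z' := by
  obtain ⟨x, q⟩ := z
  obtain ⟨x', q'⟩ := z'
  obtain rfl : x = x' := hb
  obtain ⟨s, rfl⟩ := Quotient.exists_rep q
  obtain ⟨s', rfl⟩ := Quotient.exists_rep q'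
  have h1 : jetCoord k e φ s.toFun x = jetCoord k e φ s'.toFun x := by
    rw [← coord_jet he hφ (x := x) hz, ← coord_jet he hφ (x := x) hz]; exact hc
  exact congrArg _ (Quotient.sound ((contact_iff_jetCoord_eq he hφ hz.1 hz.2).2 h1))

/-- There is a jet over `x` with prescribed coordinates, if `x` is in their domain. -/
theorem exists_jet_coord_eq (𝓕 : FilteredBundle (Euc m) EF π w) (he : e ∈ 𝓕.atlas)
    (hφ : φ ∈ IsManifold.maximalAtlas 𝓘(ℝ, Euc m) ∞ M) (x : M) (y : ι × MultiIndex m k → ℝ) :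
    ∃ z : JetBundle m EF π k, z.toBase = x ∧
      (x ∈ e.baseSet ∩ φ.source → z.coord e φ = y) := by
  by_cases hx : x ∈ e.baseSet ∩ φ.source
  · obtain ⟨s, hs⟩ := exists_jetCoord_eq (k := k) (𝓕.smooth e he) hφ hx.1 hx.2 y
    exact ⟨jet k s, rfl, fun _ => by rw [JetBundle.coord_jet (𝓕.smooth e he) hφ hx, hs]⟩
  · exact ⟨jet k (nonempty_localSection 𝓕 x).some, rfl, fun h => absurd h hx⟩

theorem exists_coord_transition (𝓕 : FilteredBundle (Euc m) EF π w) (k : ℕ)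
    (he : e ∈ 𝓕.atlas) (he' : e' ∈ 𝓕.atlas)
    (hφ : φ ∈ IsManifold.maximalAtlas 𝓘(ℝ, Euc m) ∞ M)
    (hφ' : φ' ∈ IsManifold.maximalAtlas 𝓘(ℝ, Euc m) ∞ M) (A : ι × MultiIndex m k) :
    ∃ Q : Euc m → MvPolynomial (ι × MultiIndex m k) ℝ,
      (∀ n, ContDiffOn ℝ ∞ (fun p => (Q p).coeff n) (φ'.target ∩ φ'.symm ⁻¹'
        (e.baseSet ∩ φ.source ∩ e'.baseSet))) ∧
      (∀ p, (Q p).weightedTotalDegree (fun A => (jetWeight w m k A).1) ≤ (jetWeight w m k A).1 ∧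
        (Q p).weightedTotalDegree (fun A => (jetWeight w m k A).2) ≤ (jetWeight w m k A).2) ∧
      ∀ z : JetBundle m EF π k, z.toBase ∈ e.baseSet ∩ φ.source →
        z.toBase ∈ e'.baseSet ∩ φ'.source →
        z.coord e' φ' A = MvPolynomial.eval (z.coord e φ) (Q (φ' z.toBase)) := by
  obtain ⟨Q, hQ, hd, h⟩ := exists_jetCoord_transition 𝓕 he he' hφ hφ' A
  refine ⟨Q, hQ, hd, fun z hz hz' => ?_⟩
  obtain ⟨s, hs⟩ := z.exists_eq_jet
  have h1 := h z.toBase hz hz' s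
  rw [← JetBundle.coord_jet (𝓕.smooth e' he') hφ' hz', ← JetBundle.coord_jet (𝓕.smooth e he) hφ hz,
    ← hs] at h1
  exact h1

/-- The chart of the jet bundle given by the base coordinates `φ` and the jet coordinates. -/
noncomputable def jetChart (𝓕 : FilteredBundle (Euc m) EF π w) (k : ℕ)
    (c : 𝓕.atlas × IsManifold.maximalAtlas 𝓘(ℝ, Euc m) ∞ M) :
    PartialEquiv (JetBundle m EF π k) (JetModel ι m k) where
  toFun z := (c.2.1 z.toBase, z.coord c.1.1 c.2.1)
  invFun v := (exists_jet_coord_eq 𝓕 c.1.2 c.2.2 (c.2.1.symm v.1) v.2).choose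
  source := {z | z.toBase ∈ c.1.1.baseSet ∩ c.2.1.source}
  target := {v | v.1 ∈ c.2.1.target ∧ c.2.1.symm v.1 ∈ c.1.1.baseSet}
  map_source' z hz := ⟨c.2.1.map_source hz.2, by
    simpa only [Set.mem_ofPred_eq, c.2.1.left_inv hz.2] using hz.1⟩
  map_target' v hv := by
    rw [Set.mem_ofPred_eq, (exists_jet_coord_eq 𝓕 c.1.2 c.2.2 (c.2.1.symm v.1) v.2).choose_spec.1]
    exact ⟨hv.2, c.2.1.map_target hv.1⟩
  left_inv' z hz := by
    have h := (exists_jet_coord_eq 𝓕 c.1.2 c.2.2 (c.2.1.symm (c.2.1 z.toBase))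
      (z.coord c.1.1 c.2.1)).choose_spec
    refine (JetBundle.ext_coord (𝓕.smooth _ c.1.2) c.2.2 hz ?_ ?_).symm
    · rw [h.1, c.2.1.left_inv hz.2]
    · exact (h.2 (by rwa [c.2.1.left_inv hz.2])).symm
  right_inv' v hv := by
    have h := (exists_jet_coord_eq 𝓕 c.1.2 c.2.2 (c.2.1.symm v.1) v.2).choose_spec
    refine Prod.ext ?_ (h.2 ⟨hv.2, c.2.1.map_target hv.1⟩)
    change c.2.1 (JetBundle.toBase _) = v.1
    rw [h.1, c.2.1.right_inv hv.1]

/-- No condition on `v` is needed, since the default value of the inverse chart also lies over the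
given base point. -/
theorem jetChart_symm_toBase (𝓕 : FilteredBundle (Euc m) EF π w)
    (c : 𝓕.atlas × IsManifold.maximalAtlas 𝓘(ℝ, Euc m) ∞ M) (v : JetModel ι m k) :
    ((jetChart 𝓕 k c).symm v).toBase = c.2.1.symm v.1 :=
  (exists_jet_coord_eq 𝓕 c.1.2 c.2.2 (c.2.1.symm v.1) v.2).choose_spec.1

theorem jetChart_symm_trans_source (𝓕 : FilteredBundle (Euc m) EF π w)
    (c c' : 𝓕.atlas × IsManifold.maximalAtlas 𝓘(ℝ, Euc m) ∞ M) :
    ((jetChart 𝓕 k c).symm.trans (jetChart 𝓕 k c')).source =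
      (c.2.1.target ∩ c.2.1.symm ⁻¹' (c.1.1.baseSet ∩ (c'.1.1.baseSet ∩ c'.2.1.source))) ×ˢ
        Set.univ := by
  ext v
  have h : (jetChart 𝓕 k c).symm v ∈ (jetChart 𝓕 k c').source ↔
      c.2.1.symm v.1 ∈ c'.1.1.baseSet ∩ c'.2.1.source := by
    rw [← jetChart_symm_toBase]; rfl
  rw [PartialEquiv.trans_source, Set.mem_inter_iff, Set.mem_preimage, h]
  change (_ ∧ _) ∧ _ ∧ _ ↔ _
  simp only [Set.mem_prod, Set.mem_inter_iff, Set.mem_preimage, Set.mem_univ, and_true]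
  tauto

theorem isOpen_jetChart_symm_trans_source (𝓕 : FilteredBundle (Euc m) EF π w)
    (c c' : 𝓕.atlas × IsManifold.maximalAtlas 𝓘(ℝ, Euc m) ∞ M) :
    IsOpen ((jetChart 𝓕 k c).symm.trans (jetChart 𝓕 k c')).source := by
  rw [jetChart_symm_trans_source]
  exact (c.2.1.isOpen_inter_preimage_symm (c.1.1.open_baseSet.inter
    (c'.1.1.open_baseSet.inter c'.2.1.open_source))).prod isOpen_univ

theorem contDiffOn_jetChart_symm_trans (𝓕 : FilteredBundle (Euc m) EF π w)
    (c c' : 𝓕.atlas × IsManifold.maximalAtlas 𝓘(ℝ, Euc m) ∞ M) :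
    ContDiffOn ℝ ∞ ((jetChart 𝓕 k c).symm.trans (jetChart 𝓕 k c'))
      ((jetChart 𝓕 k c).symm.trans (jetChart 𝓕 k c')).source := by
  obtain ⟨⟨e, he⟩, ⟨φ, hφ⟩⟩ := c
  obtain ⟨⟨e', he'⟩, ⟨φ', hφ'⟩⟩ := c'
  have hW := jetChart_symm_trans_source (k := k) 𝓕 ⟨⟨e, he⟩, ⟨φ, hφ⟩⟩ ⟨⟨e', he'⟩, ⟨φ', hφ'⟩⟩
  set W := φ.target ∩ φ.symm ⁻¹' (e.baseSet ∩ (e'.baseSet ∩ φ'.source)) with hWdef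
  change _ = W ×ˢ Set.univ at hW
  have hτ : ContDiffOn ℝ ∞ (φ' ∘ φ.symm) W := fun p hp =>
    (contDiffAt_comp_symm_charts hφ hφ' hp.1 hp.2.2.2).contDiffWithinAt
  have hτ' : ContDiffOn ℝ ∞ (fun v : JetModel ι m k => φ' (φ.symm v.1)) (W ×ˢ Set.univ) :=
    hτ.comp contDiffOn_fst fun v hv => hv.1
  choose Q hQ hd hQe using fun A => exists_coord_transition 𝓕 k he he' hφ hφ' A
  have hev : ∀ A, ContDiffOn ℝ ∞ (fun v : JetModel ι m k =>
      MvPolynomial.eval v.2 (Q A (φ' (φ.symm v.1)))) (W ×ˢ Set.univ) := fun A => by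
    -- The first weights are used here because they are positive; the second ones vanish for `α = 0`
    -- and would not bound the number of monomials.
    have h1 := contDiffOn_eval (wt := fun A => (jetWeight w m k A).1)
      (fun A => 𝓕.wt_ne_zero A.1) (hQ A) fun p _ => (hd A p).1
    refine h1.comp (hτ'.prodMk contDiffOn_snd) fun v hv => ⟨⟨φ'.map_source hv.1.2.2.2, ?_⟩, trivial⟩
    rw [Set.mem_preimage, φ'.left_inv hv.1.2.2.2]
    exact ⟨⟨hv.1.2.1, φ.map_target hv.1.1⟩, hv.1.2.2.1⟩
  rw [hW]
  refine (hτ'.prodMk (contDiffOn_pi.2 hev)).congr fun v hv => ?_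
  have hb := jetChart_symm_toBase (k := k) 𝓕 ⟨⟨e, he⟩, ⟨φ, hφ⟩⟩ v
  have hv' : v ∈ (jetChart 𝓕 k ⟨⟨e, he⟩, ⟨φ, hφ⟩⟩).target := ⟨hv.1.1, hv.1.2.1⟩
  have hr : ((jetChart 𝓕 k ⟨⟨e, he⟩, ⟨φ, hφ⟩⟩).symm v).coord e φ = v.2 :=
    congrArg Prod.snd ((jetChart 𝓕 k ⟨⟨e, he⟩, ⟨φ, hφ⟩⟩).right_inv hv')
  refine Prod.ext (congrArg φ' hb) (funext fun A => ?_)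
  refine (hQe A ((jetChart 𝓕 k ⟨⟨e, he⟩, ⟨φ, hφ⟩⟩).symm v) ?_ ?_).trans ?_
  · rw [hb]; exact ⟨hv.1.2.1, φ.map_target hv.1.1⟩
  · rw [hb]; exact hv.1.2.2
  · rw [hb, hr]

/-- The charts of the jet bundle. -/
noncomputable def jetCore (𝓕 : FilteredBundle (Euc m) EF π w) (k : ℕ) :
    ChartedSpaceCore (JetModel ι m k) (JetBundle m EF π k) where
  atlas := Set.range (jetChart 𝓕 k)
  chartAt z := jetChart 𝓕 k (⟨(𝓕.cover z.toBase).choose, (𝓕.cover z.toBase).choose_spec.1⟩,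
    ⟨chartAt (Euc m) z.toBase, IsManifold.chart_mem_maximalAtlas z.toBase⟩)
  mem_chart_source z := ⟨(𝓕.cover z.toBase).choose_spec.2, mem_chart_source _ _⟩
  chart_mem_atlas z := ⟨_, rfl⟩
  open_source := by
    rintro _ _ ⟨c, rfl⟩ ⟨c', rfl⟩
    exact isOpen_jetChart_symm_trans_source 𝓕 c c'
  continuousOn_toFun := by
    rintro _ _ ⟨c, rfl⟩ ⟨c', rfl⟩
    exact (contDiffOn_jetChart_symm_trans 𝓕 c c').continuousOn

theorem isManifold_jetCore (𝓕 : FilteredBundle (Euc m) EF π w) (k : ℕ) :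
    letI := (jetCore 𝓕 k).toTopologicalSpace
    letI := (jetCore 𝓕 k).toChartedSpace
    IsManifold 𝓘(ℝ, JetModel ι m k) ∞ (JetBundle m EF π k) := by
  let := (jetCore 𝓕 k).toTopologicalSpace
  let := (jetCore 𝓕 k).toChartedSpace
  refine isManifold_of_contDiffOn _ _ _ fun T T' hT hT' => ?_
  simp only [atlas, ChartedSpace.atlas, Set.mem_iUnion, Set.mem_singleton_iff] at hT hT'
  obtain ⟨_, ⟨c, rfl⟩, rfl⟩ := hT
  obtain ⟨_, ⟨c', rfl⟩, rfl⟩ := hT'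
  refine (contDiffOn_jetChart_symm_trans (k := k) 𝓕 c c').mono fun v hv => hv.1

/-- The trivialization is the jet chart followed by `φ.symm` on the base component. -/
theorem jetCoordsSmooth_jetCore (𝓕 : FilteredBundle (Euc m) EF π w) (k : ℕ) :
    letI := (jetCore 𝓕 k).toTopologicalSpace
    letI := (jetCore 𝓕 k).toChartedSpace
    JetCoordsSmooth 𝓕 k := by
  let := (jetCore 𝓕 k).toTopologicalSpace
  let := (jetCore 𝓕 k).toChartedSpace
  have := isManifold_jetCore 𝓕 k
  intro e he φ hφ
  let c : 𝓕.atlas × IsManifold.maximalAtlas 𝓘(ℝ, Euc m) ∞ M := (⟨e, he⟩, ⟨φ, hφ⟩)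
  let T := (jetCore 𝓕 k).openPartialHomeomorph (jetChart 𝓕 k c) ⟨c, rfl⟩
  have hT : T ∈ IsManifold.maximalAtlas 𝓘(ℝ, JetModel ι m k) ∞ (JetBundle m EF π k) :=
    StructureGroupoid.subset_maximalAtlas _ (Set.mem_iUnion.2 ⟨_, Set.mem_iUnion.2 ⟨⟨c, rfl⟩, rfl⟩⟩)
  let R : OpenPartialHomeomorph (JetModel ι m k) (M × (ι × MultiIndex m k → ℝ)) :=
    φ.symm.prod (OpenPartialHomeomorph.refl _)
  have hsrc : (T.trans R).source = JetBundle.toBase ⁻¹' (e.baseSet ∩ φ.source) := by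
    ext z
    refine ⟨fun hz => hz.1, fun hz => ⟨hz, ?_⟩⟩
    exact ⟨φ.map_source hz.2, trivial⟩
  have hT1 := contMDiffOn_of_mem_maximalAtlas hT
  have hT2 := contMDiffOn_symm_of_mem_maximalAtlas hT
  let t : Bundle.Trivialization (ι × MultiIndex m k → ℝ)
      (JetBundle.toBase : JetBundle m EF π k → M) :=
    { toOpenPartialHomeomorph := T.trans R
      baseSet := e.baseSet ∩ φ.source
      open_baseSet := e.open_baseSet.inter φ.open_source
      source_eq := hsrc
      target_eq := by
        ext v
        refine ⟨fun hv => ⟨⟨?_, hv.1.1⟩, trivial⟩, fun hv => ⟨⟨hv.1.2, trivial⟩, ?_⟩⟩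
        · have h : φ.symm (φ v.1) ∈ e.baseSet := hv.2.2
          rwa [φ.left_inv hv.1.1] at h
        · refine ⟨φ.map_source hv.1.2, ?_⟩
          change φ.symm (φ v.1) ∈ e.baseSet
          rw [φ.left_inv hv.1.2]
          exact hv.1.1
      proj_toFun := fun z hz => by
        rw [hsrc] at hz
        exact φ.left_inv hz.2 }
  have hR1 : ∀ v : JetModel ι m k, v.1 ∈ φ.target → ContMDiffAt 𝓘(ℝ, JetModel ι m k)
      (𝓘(ℝ, Euc m).prod 𝓘(ℝ, ι × MultiIndex m k → ℝ)) ∞ R v := fun v hv =>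
    ((contMDiffAt_chart_symm hφ hv).comp v contDiffAt_fst.contMDiffAt).prodMk
      contDiffAt_snd.contMDiffAt
  have hR2 : ∀ v : M × (ι × MultiIndex m k → ℝ), v.1 ∈ φ.source →
      ContMDiffAt (𝓘(ℝ, Euc m).prod 𝓘(ℝ, ι × MultiIndex m k → ℝ)) 𝓘(ℝ, JetModel ι m k) ∞
        R.symm v := fun v hv =>
    ((contMDiffAt_chart hφ hv).comp v contMDiffAt_fst).prodMk_space contMDiffAt_snd
  refine ⟨t, ⟨rfl, fun x hx s i α => ?_⟩, fun z hz => ?_, fun v hv => ?_⟩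
  · exact congrFun (JetBundle.coord_jet (𝓕.smooth e he) hφ hx s) (i, α)
  · have h1 : ContMDiffAt 𝓘(ℝ, JetModel ι m k) 𝓘(ℝ, JetModel ι m k) ∞ T z :=
      hT1.contMDiffAt (T.open_source.mem_nhds hz.1)
    exact ((hR1 (T z) hz.2.1).comp z h1).contMDiffWithinAt
  · have h1 : ContMDiffAt 𝓘(ℝ, JetModel ι m k) 𝓘(ℝ, JetModel ι m k) ∞ T.symm (R.symm v) :=
      hT2.contMDiffAt (T.open_target.mem_nhds hv.2)
    exact (h1.comp v (hR2 v hv.1.1)).contMDiffWithinAt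

end JetManifold

/-! ### Splitting the coordinates with respect to one of the weights -/

section Split

/-- The point of `ℝ^κ` with given coordinates of weight zero and of non-zero weight. -/
def mergeCoord {κ : Type*} (v : κ → ℕ) (y₀ : {A : κ // v A = 0} → ℝ) (y₁ : {A : κ // v A ≠ 0} → ℝ)
    (A : κ) : ℝ := if h : v A = 0 then y₀ ⟨A, h⟩ else y₁ ⟨A, h⟩

theorem mergeCoord_of_eq {κ : Type*} {v : κ → ℕ} (y₀ : {A : κ // v A = 0} → ℝ)
    (y₁ : {A : κ // v A ≠ 0} → ℝ) (A : {A : κ // v A = 0}) : mergeCoord v y₀ y₁ A = y₀ A :=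
  dif_pos A.2

theorem mergeCoord_of_ne {κ : Type*} {v : κ → ℕ} (y₀ : {A : κ // v A = 0} → ℝ)
    (y₁ : {A : κ // v A ≠ 0} → ℝ) (A : {A : κ // v A ≠ 0}) : mergeCoord v y₀ y₁ A = y₁ A :=
  dif_neg A.2

theorem mergeCoord_restrict {κ : Type*} {v : κ → ℕ} {y₀ : {A : κ // v A = 0} → ℝ}
    {y₁ : {A : κ // v A ≠ 0} → ℝ} {y : κ → ℝ} (h₀ : ∀ A, y₀ A = y A) (h₁ : ∀ A, y₁ A = y A) :
    mergeCoord v y₀ y₁ = y := by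
  ext A
  unfold mergeCoord
  split_ifs
  · exact h₀ _
  · exact h₁ _

theorem contDiff_mergeCoord {κ : Type*} [Fintype κ] (v : κ → ℕ) : ContDiff ℝ ∞
    fun y : ({A : κ // v A = 0} → ℝ) × ({A : κ // v A ≠ 0} → ℝ) => mergeCoord v y.1 y.2 := by
  refine contDiff_pi.2 fun A => ?_
  unfold mergeCoord
  split_ifs
  · fun_prop
  · fun_prop

variable {EB EN EE : Type*} [NormedAddCommGroup EB] [NormedSpace ℝ EB]
  [NormedAddCommGroup EN] [NormedSpace ℝ EN] [NormedAddCommGroup EE] [NormedSpace ℝ EE]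
  {B N E : Type*} [TopologicalSpace B] [ChartedSpace EB B]
  [TopologicalSpace N] [ChartedSpace EN N] [TopologicalSpace E] [ChartedSpace EE E]
  {κ : Type*} {π : E → B} {v : κ → ℕ} {r : N → B} {q : E → N}
  {t t' : Bundle.Trivialization (κ → ℝ) π}
  {b : Bundle.Trivialization ({A : κ // v A = 0} → ℝ) r}
  {c c' : Bundle.Trivialization ({A : κ // v A ≠ 0} → ℝ) q}

/-- Both points have the same base point and the same `b`-coordinates, and `b` is injective on its
source. -/
theorem proj_symm_merge (hcomm : ∀ z, r (q z) = π z) (hbt : b.baseSet = t.baseSet)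
    (hcoord : ∀ z ∈ t.source, ∀ A, (b (q z)).2 A = (t z).2 A) {x : N} (hx : r x ∈ t.baseSet)
    (y : {A : κ // v A ≠ 0} → ℝ) :
    q (t.toOpenPartialHomeomorph.symm (r x, mergeCoord v (b x).2 y)) = x := by
  set z := t.toOpenPartialHomeomorph.symm (r x, mergeCoord v (b x).2 y) with hz
  have hπ : π z = r x := proj_symm hx _
  have htz : t z = (r x, mergeCoord v (b x).2 y) := apply_symm hx _
  have hzs : z ∈ t.source := t.mem_source.2 (hπ ▸ hx)
  have hqs : q z ∈ b.source := b.mem_source.2 (by rwa [hcomm, hπ, hbt])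
  have hxs : x ∈ b.source := b.mem_source.2 (by rwa [hbt])
  refine b.injOn hqs hxs (Prod.ext ?_ (funext fun A => ?_))
  · change (b (q z)).1 = (b x).1
    rw [b.coe_fst hqs, b.coe_fst hxs, hcomm, hπ]
  · change (b (q z)).2 A = (b x).2 A
    rw [hcoord z hzs A, htz]
    exact mergeCoord_of_eq _ _ A

theorem split_symm_apply (hcomm : ∀ z, r (q z) = π z) (hct : c.baseSet = r ⁻¹' t.baseSet)
    (hcoord : ∀ z ∈ t.source, (∀ A, (b (q z)).2 A = (t z).2 A) ∧ ∀ A, (c z).2 A = (t z).2 A)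
    {x : N} (hx : r x ∈ t.baseSet) (y : {A : κ // v A ≠ 0} → ℝ) :
    c.toOpenPartialHomeomorph.symm (x, y) =
      t.toOpenPartialHomeomorph.symm (r x, mergeCoord v (b x).2 y) := by
  have hxc : x ∈ c.baseSet := by rwa [hct]
  set z := c.toOpenPartialHomeomorph.symm (x, y) with hz
  have hq : q z = x := proj_symm hxc y
  have hcz : c z = (x, y) := apply_symm hxc y
  have hπ : π z = r x := by rw [← hcomm, hq]
  have hzs : π z ∈ t.baseSet := hπ ▸ hx
  obtain ⟨h1, h2⟩ := hcoord z (t.mem_source.2 hzs)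
  rw [hq] at h1
  rw [hcz] at h2
  rw [mergeCoord_restrict h1 h2, ← hπ, symm_mk_snd hzs]

variable [Fintype κ]

/-- Smoothness of `q` is a consequence of the coordinate condition: locally, `q z` is the inverse of
`b` applied to `π z` and the coordinates of weight zero. -/
theorem contMDiffAt_split (hcomm : ∀ z, r (q z) = π z) (ht : IsSmoothTriv EB EE t)
    (hb : IsSmoothTriv EB EN b) (hbt : b.baseSet = t.baseSet)
    (hcoord : ∀ z ∈ t.source, ∀ A, (b (q z)).2 A = (t z).2 A) {z : E} (hz : π z ∈ t.baseSet) :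
    ContMDiffAt 𝓘(ℝ, EE) (𝓘(ℝ, EN).prod 𝓘(ℝ, {A : κ // v A ≠ 0} → ℝ)) ∞
      (fun z => (q z, fun A : {A : κ // v A ≠ 0} => (t z).2 A)) z := by
  have h2 := ht.contMDiffAt_snd hz
  have h3 : ContMDiffAt 𝓘(ℝ, EE) 𝓘(ℝ, {A : κ // v A ≠ 0} → ℝ) ∞
      (fun z => fun A : {A : κ // v A ≠ 0} => (t z).2 A) z :=
    (ContDiff.contMDiff (f := fun y : κ → ℝ => fun A : {A : κ // v A ≠ 0} => y A)
      (by fun_prop)).contMDiffAt.comp z h2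
  have h4 : ContMDiffAt 𝓘(ℝ, EE) 𝓘(ℝ, {A : κ // v A = 0} → ℝ) ∞
      (fun z => fun A : {A : κ // v A = 0} => (t z).2 A) z :=
    (ContDiff.contMDiff (f := fun y : κ → ℝ => fun A : {A : κ // v A = 0} => y A)
      (by fun_prop)).contMDiffAt.comp z h2
  have h5 : ContMDiffAt 𝓘(ℝ, EE) 𝓘(ℝ, EN) ∞ (fun z => b.toOpenPartialHomeomorph.symm
      (π z, fun A : {A : κ // v A = 0} => (t z).2 A)) z :=
    (hb.contMDiffAt_symm (z := (π z, fun A : {A : κ // v A = 0} => (t z).2 A))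
      (by rwa [hbt])).comp z ((ht.contMDiffAt_proj hz).prodMk h4)
  refine (h5.congr_of_eventuallyEq ?_).prodMk h3
  filter_upwards [t.open_source.mem_nhds (t.mem_source.2 hz)] with z' hz'
  have h6 : (fun A : {A : κ // v A = 0} => (t z').2 A) = (b (q z')).2 :=
    funext fun A => (hcoord z' hz' A).symm
  rw [h6, ← hcomm, symm_mk_snd]
  rw [hcomm, hbt]
  exact t.mem_source.1 hz'

theorem contMDiffAt_split_symm (ht : IsSmoothTriv EB EE t)
    (hb : IsSmoothTriv EB EN b) (hbt : b.baseSet = t.baseSet)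
    {u : N × ({A : κ // v A ≠ 0} → ℝ)} (hu : r u.1 ∈ t.baseSet) :
    ContMDiffAt (𝓘(ℝ, EN).prod 𝓘(ℝ, {A : κ // v A ≠ 0} → ℝ)) 𝓘(ℝ, EE) ∞
      (fun u => t.toOpenPartialHomeomorph.symm (r u.1, mergeCoord v (b u.1).2 u.2)) u := by
  have hu' : r u.1 ∈ b.baseSet := by rwa [hbt]
  have hf : ContMDiffAt (𝓘(ℝ, EN).prod 𝓘(ℝ, {A : κ // v A ≠ 0} → ℝ)) 𝓘(ℝ, EN) ∞ Prod.fst u :=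
    contMDiffAt_fst
  have h1 := (hb.contMDiffAt_snd hu').comp u hf
  have h2 := (hb.contMDiffAt_proj hu').comp u hf
  have h0 : ContMDiffAt (𝓘(ℝ, EN).prod 𝓘(ℝ, {A : κ // v A ≠ 0} → ℝ))
      𝓘(ℝ, {A : κ // v A ≠ 0} → ℝ) ∞ Prod.snd u := contMDiffAt_snd
  have h3 := (contDiff_mergeCoord v).contMDiff.contMDiffAt.comp u (h1.prodMk_space h0)
  exact (ht.contMDiffAt_symm (z := (r u.1, mergeCoord v (b u.1).2 u.2)) hu).comp u (h2.prodMk h3)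

/-- The coordinates of non-zero weight are fibre coordinates over `N`. -/
theorem exists_coordSplit (hcomm : ∀ z, r (q z) = π z) (ht : IsSmoothTriv EB EE t)
    (hb : IsSmoothTriv EB EN b) (hbt : b.baseSet = t.baseSet)
    (hcoord : ∀ z ∈ t.source, ∀ A, (b (q z)).2 A = (t z).2 A) :
    ∃ c : Bundle.Trivialization ({A : κ // v A ≠ 0} → ℝ) q, CoordSplit EB EN v r t c := by
  have hopen : IsOpen (r ⁻¹' t.baseSet) := by
    rw [← hbt, ← b.source_eq]; exact b.open_source
  have hmem : ∀ z, z ∈ t.source ↔ π z ∈ t.baseSet := fun z => t.mem_source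
  let c : Bundle.Trivialization ({A : κ // v A ≠ 0} → ℝ) q :=
    { toFun := fun z => (q z, fun A => (t z).2 A)
      invFun := fun u => t.toOpenPartialHomeomorph.symm (r u.1, mergeCoord v (b u.1).2 u.2)
      source := t.source
      target := (r ⁻¹' t.baseSet) ×ˢ Set.univ
      map_source' := fun z hz => ⟨by
        rw [Set.mem_preimage, hcomm]; exact (hmem z).1 hz, trivial⟩
      map_target' := fun u hu => (hmem _).2 (by rw [proj_symm hu.1]; exact hu.1)
      left_inv' := fun z hz => by
        change t.toOpenPartialHomeomorph.symm (r (q z), mergeCoord v (b (q z)).2 _) = z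
        rw [mergeCoord_restrict (hcoord z hz) fun A => rfl, hcomm, symm_mk_snd ((hmem z).1 hz)]
      right_inv' := fun u hu => by
        refine Prod.ext (proj_symm_merge hcomm hbt hcoord hu.1 _) (funext fun A => ?_)
        change (t (t.toOpenPartialHomeomorph.symm _)).2 A = _
        rw [apply_symm hu.1]
        exact mergeCoord_of_ne _ _ A
      open_source := t.open_source
      open_target := hopen.prod isOpen_univ
      continuousOn_toFun := fun z hz => (contMDiffAt_split hcomm ht hb hbt hcoord
        ((hmem z).1 hz)).continuousAt.continuousWithinAt
      continuousOn_invFun := fun u hu =>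
        (contMDiffAt_split_symm ht hb hbt hu.1).continuousAt.continuousWithinAt
      baseSet := r ⁻¹' t.baseSet
      open_baseSet := hopen
      source_eq := by
        ext z
        rw [hmem, Set.mem_preimage, Set.mem_preimage, hcomm]
      target_eq := rfl
      proj_toFun := fun _ _ => rfl }
  exact ⟨c, b, hb, hbt, rfl, fun z hz => ⟨hcoord z hz, fun A => rfl⟩⟩

theorem CoordSplit.isSmoothTriv (hcomm : ∀ z, r (q z) = π z) (ht : IsSmoothTriv EB EE t)
    (h : CoordSplit EB EN v r t c) : IsSmoothTriv EN EE c := by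
  obtain ⟨b, hb, hbt, hct, hcoord⟩ := h
  have hmem : ∀ z, z ∈ c.source ↔ π z ∈ t.baseSet := fun z => by
    rw [c.mem_source, hct, Set.mem_preimage, hcomm]
  refine ⟨fun z hz => ?_, fun u hu => ?_⟩
  · refine ((contMDiffAt_split hcomm ht hb hbt (fun z hz => (hcoord z hz).1)
      ((hmem z).1 hz)).congr_of_eventuallyEq ?_).contMDiffWithinAt
    filter_upwards [c.open_source.mem_nhds hz] with z' hz'
    exact Prod.ext (c.proj_toFun z' hz')
      (funext fun A => (hcoord z' (t.mem_source.2 ((hmem z').1 hz'))).2 A)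
  · have hu' : r u.1 ∈ t.baseSet := by
      have := c.mem_target.1 hu
      rwa [hct] at this
    refine ((contMDiffAt_split_symm ht hb hbt hu').congr_of_eventuallyEq ?_).contMDiffWithinAt
    filter_upwards [c.open_target.mem_nhds hu] with u' hu'
    refine split_symm_apply hcomm hct hcoord ?_ u'.2
    have := c.mem_target.1 hu'
    rwa [hct] at this

/-- The variables of `v`-weight zero are functions on `N` and move into the coefficients; they
contribute nothing to the `v`-weight, so its bound survives. The positive weights `wt` serve only to
keep the number of monomials finite, because `v` may vanish. -/
theorem CoordSplit.polyTransition {wt : κ → ℕ} (hwt : ∀ A, wt A ≠ 0) {d d' : ℕ}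
    (hcomm : ∀ z, r (q z) = π z) (hc : CoordSplit EB EN v r t c) (hc' : CoordSplit EB EN v r t' c')
    (A : {A : κ // v A ≠ 0})
    (hP : PolyTransition EB t t' A fun P =>
      P.weightedTotalDegree wt ≤ d ∧ P.weightedTotalDegree v ≤ d') :
    PolyTransition EN c c' A fun P =>
      P.weightedTotalDegree (fun A : {A : κ // v A ≠ 0} => v A) ≤ d' := by
  classical
  obtain ⟨P, hP, hPe⟩ := hP
  obtain ⟨b, hb, hbt, hct, hcoord⟩ := hc
  obtain ⟨b', hb', hbt', hct', hcoord'⟩ := hc'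
  have hS := Finsupp.finite_of_nat_weight_le wt hwt d
  set S := hS.toFinset.filter fun n => Finsupp.weight v n ≤ d' with hSdef
  let C : N → (κ →₀ ℕ) → ℝ := fun x n =>
    (P (r x)).coeff n * ∏ A : {A : κ // v A = 0}, (b x).2 A ^ n A
  have hC : ∀ n, ContMDiffOn 𝓘(ℝ, EN) 𝓘(ℝ, ℝ) ∞ (fun x => C x n) (c.baseSet ∩ c'.baseSet) := by
    intro n x hx
    rw [hct, hct'] at hx
    have hxb : r x ∈ b.baseSet := by rw [hbt]; exact hx.1
    have h1 : ContMDiffAt 𝓘(ℝ, EN) 𝓘(ℝ, ℝ) ∞ (fun x => (P (r x)).coeff n) x :=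
      ((hP n).contMDiffAt ((t.open_baseSet.inter t'.open_baseSet).mem_nhds hx)).comp x
        (hb.contMDiffAt_proj hxb)
    have h2 : ContMDiffAt 𝓘(ℝ, EN) 𝓘(ℝ, ℝ) ∞
        (fun x => ∏ A : {A : κ // v A = 0}, (b x).2 A ^ n A) x :=
      (ContDiff.contMDiff (f := fun y : {A : κ // v A = 0} → ℝ => ∏ A, y A ^ n A)
        (by fun_prop)).contMDiffAt.comp x (hb.contMDiffAt_snd hxb)
    exact ((contDiff_mul (𝕜 := ℝ) (𝔸 := ℝ) (n := ∞)).contMDiff.contMDiffAt.comp x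
      (h1.prodMk_space h2)).contMDiffWithinAt
  -- Different exponents may agree on the variables of non-zero weight, so one coefficient of the
  -- new polynomial can collect several terms.
  refine ⟨fun x => ∑ n ∈ S, MvPolynomial.monomial (n.subtypeDomain fun A => v A ≠ 0) (C x n),
    fun n' => ?_, fun x hx => ⟨?_, fun y => ?_⟩⟩
  · simp only [MvPolynomial.coeff_sum, MvPolynomial.coeff_monomial]
    refine contMDiffOn_finsetSum fun n _ => ?_
    split_ifs
    · exact hC n
    · exact contMDiffOn_const
  · refine Finset.sup_le fun n' hn' => ?_
    rw [MvPolynomial.mem_support_iff, MvPolynomial.coeff_sum] at hn'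
    obtain ⟨n, hn, hne⟩ := Finset.exists_ne_zero_of_sum_ne_zero hn'
    rw [MvPolynomial.coeff_monomial] at hne
    obtain rfl : n.subtypeDomain (fun A => v A ≠ 0) = n' := by
      by_contra h; exact hne (if_neg h)
    refine le_trans ?_ (Finset.mem_filter.1 hn).2
    rw [Finsupp.weight_apply, Finsupp.weight_apply, Finsupp.sum_fintype _ _ (by simp),
      Finsupp.sum_fintype _ _ (by simp), ← Fintype.sum_subtype_add_sum_subtype (fun A => v A = 0)]
    exact Nat.le_add_left _ _
  · rw [hct, hct'] at hx
    rw [split_symm_apply hcomm hct hcoord hx.1]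
    set Y := mergeCoord v (b x).2 y with hY
    set z := t.toOpenPartialHomeomorph.symm (r x, Y) with hz
    have hπ : π z = r x := proj_symm hx.1 _
    have hz' : z ∈ t'.source := t'.mem_source.2 (hπ ▸ hx.2)
    rw [(hcoord' z hz').2 A, (hPe (r x) hx).2 Y, MvPolynomial.eval_eq', map_sum]
    have hsub : (P (r x)).support ⊆ S := fun n hn => by
      refine Finset.mem_filter.2 ⟨hS.mem_toFinset.2 ?_, ?_⟩
      · exact (MvPolynomial.le_weightedTotalDegree wt hn).trans (hPe (r x) hx).1.1
      · exact (MvPolynomial.le_weightedTotalDegree v hn).trans (hPe (r x) hx).1.2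
    rw [Finset.sum_subset hsub fun n _ hn => by
      rw [MvPolynomial.notMem_support_iff.1 hn, zero_mul]]
    refine Finset.sum_congr rfl fun n _ => ?_
    rw [MvPolynomial.eval_monomial, Finsupp.prod_fintype _ _ (by simp),
      ← Fintype.prod_subtype_mul_prod_subtype (fun A => v A = 0), ← mul_assoc]
    simp only [C, hY, mergeCoord_of_eq, Finsupp.subtypeDomain_apply]
    congr 1
    exact Finset.prod_congr rfl fun A _ => by rw [mergeCoord_of_ne _ _ A]

/-- A double filtered bundle whose coordinates of `v`-weight zero are coordinates on `N` has a
filtered bundle structure over `N`. -/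
theorem exists_isStructureOver {wt : κ → ℕ × ℕ} (D : DoubleFilteredBundle EB EE π wt)
    {wt' : κ → ℕ} (hwt : ∀ A, wt' A ≠ 0) (hcomm : ∀ z, r (q z) = π z)
    (htr : ∀ t ∈ D.atlas, ∀ t' ∈ D.atlas, ∀ A, PolyTransition EB t t' A fun P =>
      P.weightedTotalDegree wt' ≤ wt' A ∧ P.weightedTotalDegree v ≤ v A)
    (hb : ∀ t ∈ D.atlas, ∃ b : Bundle.Trivialization ({A : κ // v A = 0} → ℝ) r,
      IsSmoothTriv EB EN b ∧ b.baseSet = t.baseSet ∧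
        ∀ z ∈ t.source, ∀ A, (b (q z)).2 A = (t z).2 A) :
    ∃ S : FilteredBundle EN EE q fun A : {A : κ // v A ≠ 0} => v A, IsStructureOver D v r S := by
  have hex : ∀ t ∈ D.atlas, ∃ c, CoordSplit EB EN v r (q := q) t c := fun t ht => by
    obtain ⟨b, hb, hbt, hcoord⟩ := hb t ht
    exact exists_coordSplit hcomm (D.smooth t ht) hb hbt hcoord
  refine ⟨{ atlas := {c | ∃ t ∈ D.atlas, CoordSplit EB EN v r t c}
            wt_ne_zero := fun A => A.2
            cover := fun x => ?_
            smooth := ?_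
            transition := ?_ }, hcomm, fun t ht => ?_, fun c hc => hc⟩
  · obtain ⟨t, ht, hx⟩ := D.cover (r x)
    obtain ⟨c, hc⟩ := hex t ht
    refine ⟨c, ⟨t, ht, hc⟩, ?_⟩
    obtain ⟨b, -, -, hct, -⟩ := hc
    rwa [hct]
  · rintro c ⟨t, ht, hc⟩
    exact hc.isSmoothTriv hcomm (D.smooth t ht)
  · rintro c ⟨t, ht, hc⟩ c' ⟨t', ht', hc'⟩ A
    exact hc.polyTransition hwt hcomm hc' A (htr t ht t' ht' A)
  · obtain ⟨c, hc⟩ := hex t ht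
    exact ⟨c, ⟨t, ht, hc⟩, hc⟩

end Split

/-! ### Comparison of smooth trivializations -/

section Compare

variable {EB E₁ E₂ : Type*} [NormedAddCommGroup EB] [NormedSpace ℝ EB]
  [NormedAddCommGroup E₁] [NormedSpace ℝ E₁] [NormedAddCommGroup E₂] [NormedSpace ℝ E₂]
  {B X₁ X₂ : Type*} [TopologicalSpace B] [ChartedSpace EB B]
  [TopologicalSpace X₁] [ChartedSpace E₁ X₁] [TopologicalSpace X₂] [ChartedSpace E₂ X₂]
  {κ : Type*} [Fintype κ] {π₁ : X₁ → B} {π₂ : X₂ → B}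

/-- A map which is the identity in smooth trivializations is smooth. -/
theorem contMDiffAt_of_trivialization {t₁ : Bundle.Trivialization (κ → ℝ) π₁}
    {t₂ : Bundle.Trivialization (κ → ℝ) π₂} (h₁ : IsSmoothTriv EB E₁ t₁)
    (h₂ : IsSmoothTriv EB E₂ t₂) {f : X₁ → X₂} (hf : ∀ z, π₂ (f z) = π₁ z)
    (hb : t₁.baseSet = t₂.baseSet)
    (hc : ∀ z, π₁ z ∈ t₁.baseSet → (t₂ (f z)).2 = (t₁ z).2) {z : X₁} (hz : π₁ z ∈ t₁.baseSet) :
    ContMDiffAt 𝓘(ℝ, E₁) 𝓘(ℝ, E₂) ∞ f z := by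
  have h3 : ContMDiffAt 𝓘(ℝ, E₁) 𝓘(ℝ, E₂) ∞
      (fun z => t₂.toOpenPartialHomeomorph.symm (t₁ z)) z :=
    (h₂.contMDiffAt_symm (z := t₁ z) (by rwa [t₁.coe_fst' hz, ← hb])).comp z (h₁.contMDiffAt hz)
  refine h3.congr_of_eventuallyEq ?_
  filter_upwards [t₁.open_source.mem_nhds (t₁.mem_source.2 hz)] with z' hz'
  have hz'' := t₁.mem_source.1 hz'
  have h4 : t₁ z' = (π₂ (f z'), (t₂ (f z')).2) :=
    Prod.ext ((t₁.coe_fst' hz'').trans (hf z').symm) (hc z' hz'').symm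
  rw [h4, symm_mk_snd]
  rwa [hf, ← hb]

/-- Base set and fibre coordinates determine a trivialization and its inverse on their domains.
Hence every trivialization given by jet coordinates is smooth, not only the one whose existence is
assumed. -/
theorem IsSmoothTriv.congr {t t₀ : Bundle.Trivialization (κ → ℝ) π₁} (h : IsSmoothTriv EB E₁ t₀)
    (hb : t.baseSet = t₀.baseSet) (hc : ∀ z, π₁ z ∈ t.baseSet → (t z).2 = (t₀ z).2) :
    IsSmoothTriv EB E₁ t := by
  have heq : ∀ z, π₁ z ∈ t.baseSet → t z = t₀ z := fun z hz =>
    Prod.ext ((t.coe_fst' hz).trans (t₀.coe_fst' (hb ▸ hz)).symm) (hc z hz)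
  refine ⟨fun z hz => ?_, fun u hu => ?_⟩
  · have hz' := t.mem_source.1 hz
    refine ((h.contMDiffAt (hb ▸ hz')).congr_of_eventuallyEq ?_).contMDiffWithinAt
    filter_upwards [t.open_source.mem_nhds hz] with z' hz' using heq z' (t.mem_source.1 hz')
  · have hu' := t.mem_target.1 hu
    refine ((h.contMDiffAt_symm (z := u) (hb ▸ hu')).congr_of_eventuallyEq ?_).contMDiffWithinAt
    filter_upwards [t.open_target.mem_nhds hu] with u' hu'
    have h1 := t.mem_target.1 hu'
    have h2 : π₁ (t.toOpenPartialHomeomorph.symm u') = u'.1 := proj_symm h1 u'.2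
    have h3 := heq _ (h2.symm ▸ h1)
    rw [show t (t.toOpenPartialHomeomorph.symm u') = u' from apply_symm h1 u'.2] at h3
    have h4 := t₀.left_inv (t₀.mem_source.2 (by rw [h2, ← hb]; exact h1))
    exact h4.symm.trans (congrArg t₀.toOpenPartialHomeomorph.symm h3.symm)

end Compare

/-! ### Fibre coordinates on the intermediate space -/

section BaseCoordinates

variable {EB EE : Type*} [NormedAddCommGroup EB] [NormedSpace ℝ EB]
  [NormedAddCommGroup EE] [NormedSpace ℝ EE]
  {B E : Type*} [TopologicalSpace B] [ChartedSpace EB B]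
  [TopologicalSpace E] [ChartedSpace EE E]

/-- Smooth fibre coordinates can be restricted to an open set and transformed linearly. -/
theorem exists_smoothTriv_restrict {ι κ : Type*} [Fintype ι] [Fintype κ] {π : E → B}
    {e : Bundle.Trivialization (ι → ℝ) π} (he : IsSmoothTriv EB EE e) {U : Set B} (hU : IsOpen U)
    (σ : κ ≃ ι) : ∃ b : Bundle.Trivialization (κ → ℝ) π, IsSmoothTriv EB EE b ∧
      b.baseSet = e.baseSet ∩ U ∧ ∀ z A, (b z).2 A = (e z).2 (σ A) := by
  let h : (ι → ℝ) ≃ₜ (κ → ℝ) :=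
    { toFun := fun y A => y (σ A)
      invFun := fun y i => y (σ.symm i)
      left_inv := fun y => by ext; simp
      right_inv := fun y => by ext; simp
      continuous_toFun := by fun_prop
      continuous_invFun := by fun_prop }
  refine ⟨(e.restrOpen U hU).transFiberHomeomorph h, ⟨fun z hz => ?_, fun u hu => ?_⟩, rfl,
    fun z A => rfl⟩
  · have hz' := ((e.restrOpen U hU).transFiberHomeomorph h).mem_source.1 hz
    have h1 : ContMDiffAt 𝓘(ℝ, EE) 𝓘(ℝ, κ → ℝ) ∞ (fun z => fun A => (e z).2 (σ A)) z :=
      (ContDiff.contMDiff (f := fun y : ι → ℝ => fun A => y (σ A))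
        (by fun_prop)).contMDiffAt.comp z (he.contMDiffAt_snd hz'.1)
    exact ((contMDiffAt_fst.comp z (he.contMDiffAt hz'.1)).prodMk h1).contMDiffWithinAt
  · have hu' := ((e.restrOpen U hU).transFiberHomeomorph h).mem_target.1 hu
    have h1 : ContMDiffAt (𝓘(ℝ, EB).prod 𝓘(ℝ, κ → ℝ)) 𝓘(ℝ, ι → ℝ) ∞
        (fun u : B × (κ → ℝ) => fun i => u.2 (σ.symm i)) u :=
      (ContDiff.contMDiff (f := fun y : κ → ℝ => fun i => y (σ.symm i))
        (by fun_prop)).contMDiffAt.comp u contMDiffAt_snd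
    exact ((he.contMDiffAt_symm (z := (u.1, fun i => u.2 (σ.symm i))) hu'.1).comp u
      (contMDiffAt_fst.prodMk h1)).contMDiffWithinAt

/-- The identity is a bundle with fibre a point. -/
theorem exists_smoothTriv_id {κ : Type*} [Fintype κ] [IsEmpty κ] {U : Set B} (hU : IsOpen U) :
    ∃ b : Bundle.Trivialization (κ → ℝ) (id : B → B), IsSmoothTriv EB EB b ∧ b.baseSet = U := by
  let b : Bundle.Trivialization (κ → ℝ) (id : B → B) :=
    { toFun := fun x => (x, 0)
      invFun := Prod.fst
      source := U
      target := U ×ˢ Set.univ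
      map_source' := fun x hx => ⟨hx, trivial⟩
      map_target' := fun u hu => hu.1
      left_inv' := fun _ _ => rfl
      right_inv' := fun u _ => Prod.ext rfl (Subsingleton.elim _ _)
      open_source := hU
      open_target := hU.prod isOpen_univ
      continuousOn_toFun := by fun_prop
      continuousOn_invFun := by fun_prop
      baseSet := U
      open_baseSet := hU
      source_eq := rfl
      target_eq := rfl
      proj_toFun := fun _ _ => rfl }
  exact ⟨b, ⟨contMDiffOn_id.prodMk contMDiffOn_const, contMDiffOn_fst⟩, rfl⟩

end BaseCoordinates

/-! ### Consequences of the smoothness of the jet coordinates -/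

/-- The coordinates `Y^I_α` with `α = 0` correspond to the fibre coordinates. -/
def zeroOrderEquiv {ι : Type*} (w : ι → ℕ) (m k : ℕ) :
    {A : ι × MultiIndex m k // (jetWeight w m k A).2 = 0} ≃ ι where
  toFun A := A.1.1
  invFun i := ⟨(i, ⟨fun _ => 0, by simp⟩), by simp [jetWeight, MultiIndex.order]⟩
  left_inv := by
    rintro ⟨⟨i, α⟩, hα⟩
    refine Subtype.ext (Prod.ext rfl (Subtype.ext (funext fun a => Fin.ext ?_)))
    exact (Finset.sum_eq_zero_iff.1 (show ∑ a, (α.1 a : ℕ) = 0 from hα) a (Finset.mem_univ a)).symm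
  right_inv _ := rfl

/-- The order of a partial derivative is a sum that is only propositionally zero, while the type of
the argument `v` depends on it. -/
theorem iteratedFDeriv_of_eq_zero {E G : Type*} [NormedAddCommGroup E] [NormedSpace ℝ E]
    [NormedAddCommGroup G] [NormedSpace ℝ G] {n : ℕ} (hn : n = 0) (f : E → G) (p : E)
    (v : Fin n → E) : iteratedFDeriv ℝ n f p v = f p := by
  subst hn; simp

theorem exists_multiIndex {m k v : ℕ} (hv : v ≤ k) (h : 0 < m ∨ v = 0) :
    ∃ α : MultiIndex m k, α.order = v := by
  rcases h with h | rfl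
  · have hs : ∑ a : Fin m, ((if a = ⟨0, h⟩ then (⟨v, Nat.lt_succ_of_le hv⟩ : Fin (k + 1)) else 0 :
        Fin (k + 1)) : ℕ) = v := by
      rw [Finset.sum_eq_single ⟨0, h⟩] <;> simp +contextual
    exact ⟨⟨fun a => if a = ⟨0, h⟩ then ⟨v, Nat.lt_succ_of_le hv⟩ else 0, hs.trans_le hv⟩, hs⟩
  · exact ⟨⟨fun _ => 0, by simp⟩, by simp [MultiIndex.order]⟩

section JetCoords

variable {m : ℕ} {M : Type*} [TopologicalSpace M] [ChartedSpace (Euc m) M]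
  {EF : Type*} [NormedAddCommGroup EF] [NormedSpace ℝ EF]
  {F : Type*} [TopologicalSpace F] [ChartedSpace EF F]
  {ι : Type*} {π : F → M} {w : ι → ℕ} {k : ℕ}

theorem JetBundle.proj_toTotal (z : JetBundle m EF π k) : π z.toTotal = z.toBase := by
  obtain ⟨s, hs⟩ := z.exists_eq_jet
  rw [hs]
  exact s.proj_self

theorem IsJetTriv.apply_snd [TopologicalSpace (JetBundle m EF π k)]
    {e : Bundle.Trivialization (ι → ℝ) π} {φ : OpenPartialHomeomorph M (Euc m)}
    {t : Bundle.Trivialization (ι × MultiIndex m k → ℝ)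
      (JetBundle.toBase : JetBundle m EF π k → M)} (h : IsJetTriv e φ t) {x : M}
    (hx : x ∈ t.baseSet) (s : LocalSection m EF π x) :
    (t (jet k s)).2 = jetCoord k e φ s.toFun x :=
  funext fun A => h.coord x hx s A.1 A.2

theorem IsJetTriv.snd_eq_coord [TopologicalSpace (JetBundle m EF π k)]
    {e : Bundle.Trivialization (ι → ℝ) π} {φ : OpenPartialHomeomorph M (Euc m)}
    {t : Bundle.Trivialization (ι × MultiIndex m k → ℝ)
      (JetBundle.toBase : JetBundle m EF π k → M)} (h : IsJetTriv e φ t) (z : JetBundle m EF π k)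
    (hz : z.toBase ∈ e.baseSet ∩ φ.source) : (t z).2 = z.coord e φ := by
  have h1 := h.apply_snd (x := z.toBase) (by rw [h.baseSet_eq]; exact hz) z.2.out
  have h2 : jet k z.2.out = z := congrArg (Sigma.mk z.1) (Quotient.out_eq z.2)
  exact (congrArg (fun z => (t z).2) h2.symm).trans h1

theorem IsJetTriv.isSmoothTriv [Fintype ι] {𝓕 : FilteredBundle (Euc m) EF π w}
    [TopologicalSpace (JetBundle m EF π k)] [ChartedSpace (JetModel ι m k) (JetBundle m EF π k)]
    (h : JetCoordsSmooth 𝓕 k) {e : Bundle.Trivialization (ι → ℝ) π}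
    (he : e ∈ 𝓕.atlas) {φ : OpenPartialHomeomorph M (Euc m)}
    (hφ : φ ∈ IsManifold.maximalAtlas 𝓘(ℝ, Euc m) ∞ M)
    {t : Bundle.Trivialization (ι × MultiIndex m k → ℝ)
      (JetBundle.toBase : JetBundle m EF π k → M)} (ht : IsJetTriv e φ t) :
    IsSmoothTriv (Euc m) (JetModel ι m k) t := by
  obtain ⟨t', ht', hts'⟩ := h e he φ hφ
  exact hts'.congr (ht.baseSet_eq.trans ht'.baseSet_eq.symm) fun z hz => by
    rw [ht.baseSet_eq] at hz
    rw [ht.snd_eq_coord z hz, ht'.snd_eq_coord z hz]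

theorem IsJetTriv.polyTransition [Fintype ι] [TopologicalSpace (JetBundle m EF π k)]
    {𝓕 : FilteredBundle (Euc m) EF π w} {e e' : Bundle.Trivialization (ι → ℝ) π}
    {φ φ' : OpenPartialHomeomorph M (Euc m)} (he : e ∈ 𝓕.atlas) (he' : e' ∈ 𝓕.atlas)
    (hφ : φ ∈ IsManifold.maximalAtlas 𝓘(ℝ, Euc m) ∞ M)
    (hφ' : φ' ∈ IsManifold.maximalAtlas 𝓘(ℝ, Euc m) ∞ M)
    {t t' : Bundle.Trivialization (ι × MultiIndex m k → ℝ)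
      (JetBundle.toBase : JetBundle m EF π k → M)} (ht : IsJetTriv e φ t) (ht' : IsJetTriv e' φ' t')
    (A : ι × MultiIndex m k) :
    PolyTransition (Euc m) t t' A fun P =>
      P.weightedTotalDegree (fun C => (jetWeight w m k C).1) ≤ (jetWeight w m k A).1 ∧
      P.weightedTotalDegree (fun C => (jetWeight w m k C).2) ≤ (jetWeight w m k A).2 := by
  obtain ⟨Q, hQ, hd, hQe⟩ := exists_jetCoord_transition 𝓕 he he' hφ hφ' A
  refine ⟨fun x => Q (φ' x), fun n x hx => ?_, fun x hx => ⟨hd _, fun y => ?_⟩⟩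
  · rw [ht.baseSet_eq, ht'.baseSet_eq] at hx
    have hW : IsOpen (φ'.target ∩ φ'.symm ⁻¹' (e.baseSet ∩ φ.source ∩ e'.baseSet)) :=
      φ'.isOpen_inter_preimage_symm
        ((e.open_baseSet.inter φ.open_source).inter e'.open_baseSet)
    have hx' : φ' x ∈ φ'.target ∩ φ'.symm ⁻¹' (e.baseSet ∩ φ.source ∩ e'.baseSet) :=
      ⟨φ'.map_source hx.2.2, by rw [Set.mem_preimage, φ'.left_inv hx.2.2]; exact ⟨hx.1, hx.2.1⟩⟩
    exact (((hQ n).contDiffAt (hW.mem_nhds hx')).contMDiffAt.comp x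
      (contMDiffAt_chart hφ' hx.2.2)).contMDiffWithinAt
  -- Every point of the fibre is the jet of a section, so the identity for sections yields the
  -- polynomial identity for all `y`.
  · set z := t.toOpenPartialHomeomorph.symm (x, y) with hz
    have hb : z.toBase = x := proj_symm (π := (JetBundle.toBase : JetBundle m EF π k → M)) hx.1 y
    have htz : t z = (x, y) := apply_symm hx.1 y
    obtain ⟨s, hs⟩ := z.exists_eq_jet
    have hx1 : z.toBase ∈ t.baseSet := hb ▸ hx.1
    have hx2 : z.toBase ∈ t'.baseSet := hb ▸ hx.2
    have h1 := ht.apply_snd hx1 s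
    have h2 := ht'.apply_snd hx2 s
    rw [← hs] at h1 h2
    rw [htz] at h1
    have h3 := hQe z.toBase (ht.baseSet_eq ▸ hx1) (ht'.baseSet_eq ▸ hx2) s
    rw [h2, h3, ← h1, hb]

variable [IsManifold 𝓘(ℝ, Euc m) ∞ M] [Fintype ι] (𝓕 : FilteredBundle (Euc m) EF π w)

theorem exists_jetTriv_mem [TopologicalSpace (JetBundle m EF π k)]
    [ChartedSpace (JetModel ι m k) (JetBundle m EF π k)] (h : JetCoordsSmooth 𝓕 k) (x : M) :
    ∃ e ∈ 𝓕.atlas, ∃ φ ∈ IsManifold.maximalAtlas 𝓘(ℝ, Euc m) ∞ M,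
      ∃ t : Bundle.Trivialization (ι × MultiIndex m k → ℝ)
        (JetBundle.toBase : JetBundle m EF π k → M),
        IsJetTriv e φ t ∧ IsSmoothTriv (Euc m) (JetModel ι m k) t ∧ x ∈ t.baseSet := by
  obtain ⟨e, he, hx⟩ := 𝓕.cover x
  have hφ : chartAt (Euc m) x ∈ IsManifold.maximalAtlas 𝓘(ℝ, Euc m) ∞ M :=
    IsManifold.chart_mem_maximalAtlas x
  obtain ⟨t, ht, ht'⟩ := h e he _ hφ
  exact ⟨e, he, _, hφ, t, ht, ht', by rw [ht.baseSet_eq]; exact ⟨hx, mem_chart_source _ x⟩⟩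

/-- Both structures have smooth trivializations with the same jet coordinates, in which the identity
map is the identity. Exchanging the structures gives the other half of uniqueness. -/
theorem contMDiff_id_of_jetCoordsSmooth {T T' : TopologicalSpace (JetBundle m EF π k)}
    {C : @ChartedSpace (JetModel ι m k) _ (JetBundle m EF π k) T}
    {C' : @ChartedSpace (JetModel ι m k) _ (JetBundle m EF π k) T'}
    (h : @JetCoordsSmooth m M _ _ EF _ _ F _ _ ι _ π w 𝓕 k T C)
    (h' : @JetCoordsSmooth m M _ _ EF _ _ F _ _ ι _ π w 𝓕 k T' C') :
    @ContMDiff ℝ _ (JetModel ι m k) _ _ (JetModel ι m k) _ 𝓘(ℝ, JetModel ι m k)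
      (JetBundle m EF π k) T C (JetModel ι m k) _ _ (JetModel ι m k) _ 𝓘(ℝ, JetModel ι m k)
      (JetBundle m EF π k) T' C' ∞ id := fun z => by
  obtain ⟨e, he, φ, hφ, t, ht, hts, hz⟩ := @exists_jetTriv_mem m M _ _ EF _ _ F _ _ ι π w k _ _ 𝓕
    T C h z.toBase
  obtain ⟨t', ht', hts'⟩ := h' e he φ hφ
  exact @contMDiffAt_of_trivialization (Euc m) (JetModel ι m k) (JetModel ι m k) _ _ _ _ _ _ M
    (JetBundle m EF π k) (JetBundle m EF π k) _ _ T C T' C' (ι × MultiIndex m k) _ _ _ t t' hts hts'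
    id (fun _ => rfl)
    ((@IsJetTriv.baseSet_eq m M _ _ EF _ _ F _ _ ι π k T e φ t ht).trans ht'.baseSet_eq.symm)
    (fun z hz => by
      rw [@IsJetTriv.baseSet_eq m M _ _ EF _ _ F _ _ ι π k T e φ t ht] at hz
      exact (ht'.snd_eq_coord z hz).trans
        (@IsJetTriv.snd_eq_coord m M _ _ EF _ _ F _ _ ι π k T e φ t ht z hz).symm) z hz

/-! ### Topology and filtered structures of the jet bundle -/

variable [TopologicalSpace (JetBundle m EF π k)]
  [ChartedSpace (JetModel ι m k) (JetBundle m EF π k)]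

/-- Jets over different points are separated in `M`; jets over the same point lie in one
trivialization, whose target is Hausdorff. -/
theorem t2Space_jetBundle [T2Space M] (h : JetCoordsSmooth 𝓕 k) : T2Space (JetBundle m EF π k) := by
  have hcont : Continuous (JetBundle.toBase : JetBundle m EF π k → M) :=
    continuous_iff_continuousAt.2 fun z => by
      obtain ⟨_, _, _, _, t, _, _, hz⟩ := exists_jetTriv_mem 𝓕 h z.toBase
      exact t.continuousAt_proj (t.mem_source.2 hz)
  refine ⟨fun z z' hne => ?_⟩
  by_cases hb : z.toBase = z'.toBase
  · obtain ⟨_, _, _, _, t, _, _, hz⟩ := exists_jetTriv_mem 𝓕 h z.toBase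
    have hs : z ∈ t.source := t.mem_source.2 hz
    have hs' : z' ∈ t.source := t.mem_source.2 (hb ▸ hz)
    obtain ⟨u, u', hu, hu', hzu, hzu', hd⟩ := t2_separation (fun he => hne (t.injOn hs hs' he))
    refine ⟨_, _, t.toOpenPartialHomeomorph.isOpen_inter_preimage hu,
      t.toOpenPartialHomeomorph.isOpen_inter_preimage hu', ⟨hs, hzu⟩, ⟨hs', hzu'⟩, ?_⟩
    exact (hd.preimage _).mono Set.inter_subset_right Set.inter_subset_right
  · obtain ⟨u, u', hu, hu', hzu, hzu', hd⟩ := t2_separation hb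
    exact ⟨_, _, hu.preimage hcont, hu'.preimage hcont, hzu, hzu', hd.preimage _⟩

/-- By the Lindelöf property of `M`, countably many trivializations cover, and the source of each is
second countable. -/
theorem secondCountableTopology_jetBundle [SecondCountableTopology M] (h : JetCoordsSmooth 𝓕 k) :
    SecondCountableTopology (JetBundle m EF π k) := by
  choose e he φ hφ t ht hts hx using fun x => exists_jetTriv_mem 𝓕 h x
  obtain ⟨S, hS, hcov⟩ := TopologicalSpace.countable_cover_nhds
    fun x => (t x).open_baseSet.mem_nhds (hx x)
  have := hS.to_subtype
  have (x : S) : SecondCountableTopology (t x).source :=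
    (t x).toOpenPartialHomeomorph.secondCountableTopology_source
  refine TopologicalSpace.secondCountableTopology_of_countable_cover
    (fun x : S => (t x).open_source) (Set.eq_univ_of_forall fun z => ?_)
  have hz : z.toBase ∈ ⋃ x ∈ S, (t x).baseSet := hcov ▸ Set.mem_univ _
  obtain ⟨x, hxS, hz⟩ := Set.mem_iUnion₂.1 hz
  exact Set.mem_iUnion.2 ⟨⟨x, hxS⟩, (t x).mem_source.2 hz⟩

/-- The double filtered bundle structure of the jet bundle. -/
def jetDoubleFiltered (h : JetCoordsSmooth 𝓕 k) :
    DoubleFilteredBundle (Euc m) (JetModel ι m k)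
      (JetBundle.toBase : JetBundle m EF π k → M) (jetWeight w m k) where
  atlas := {t | ∃ e ∈ 𝓕.atlas, ∃ φ ∈ IsManifold.maximalAtlas 𝓘(ℝ, Euc m) ∞ M, IsJetTriv e φ t}
  wt_ne_zero A hA := 𝓕.wt_ne_zero A.1 (congrArg Prod.fst hA)
  cover x := by
    obtain ⟨e, he, φ, hφ, t, ht, -, hx⟩ := exists_jetTriv_mem 𝓕 h x
    exact ⟨t, ⟨e, he, φ, hφ, ht⟩, hx⟩
  smooth := by
    rintro t ⟨e, he, φ, hφ, ht⟩
    exact ht.isSmoothTriv h he hφ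
  transition := by
    rintro t ⟨e, he, φ, hφ, ht⟩ t' ⟨e', he', φ', hφ', ht'⟩ A
    exact ht.polyTransition he he' hφ hφ' ht' A

/-- No first weight is zero, so no coordinates descend: the intermediate space is `M` itself, with
fibre a point. -/
theorem exists_isStructureOver_base (h : JetCoordsSmooth 𝓕 k) :
    ∃ S : FilteredBundle (Euc m) (JetModel ι m k)
        (JetBundle.toBase : JetBundle m EF π k → M)
        (fun A : {A // (jetWeight w m k A).1 ≠ 0} => (jetWeight w m k A).1),
      IsStructureOver (jetDoubleFiltered 𝓕 h) (fun A => (jetWeight w m k A).1) (id : M → M) S := by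
  have : IsEmpty {A : ι × MultiIndex m k // (jetWeight w m k A).1 = 0} :=
    ⟨fun A => 𝓕.wt_ne_zero A.1.1 A.2⟩
  refine exists_isStructureOver (jetDoubleFiltered 𝓕 h) (wt' := fun A => (jetWeight w m k A).1)
    (fun A => 𝓕.wt_ne_zero A.1) (fun _ => rfl) (fun t ht t' ht' A => ?_) fun t ht => ?_
  · obtain ⟨P, hP, hPe⟩ := (jetDoubleFiltered 𝓕 h).transition t ht t' ht' A
    exact ⟨P, hP, fun x hx => ⟨⟨(hPe x hx).1.1, (hPe x hx).1.1⟩, (hPe x hx).2⟩⟩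
  · obtain ⟨b, hb, hbt⟩ := exists_smoothTriv_id (EB := Euc m)
      (κ := {A : ι × MultiIndex m k // (jetWeight w m k A).1 = 0}) t.open_baseSet
    exact ⟨b, hb, hbt, fun z _ A => isEmptyElim A⟩

theorem exists_isStructureOver_total (h : JetCoordsSmooth 𝓕 k) :
    ∃ S : FilteredBundle EF (JetModel ι m k)
        (JetBundle.toTotal : JetBundle m EF π k → F)
        (fun A : {A // (jetWeight w m k A).2 ≠ 0} => (jetWeight w m k A).2),
      IsStructureOver (jetDoubleFiltered 𝓕 h) (fun A => (jetWeight w m k A).2) π S := by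
  refine exists_isStructureOver (jetDoubleFiltered 𝓕 h) (wt' := fun A => (jetWeight w m k A).1)
    (fun A => 𝓕.wt_ne_zero A.1) JetBundle.proj_toTotal (jetDoubleFiltered 𝓕 h).transition ?_
  rintro t ⟨e, he, φ, hφ, ht⟩
  -- The coordinates that descend to `F` are those of `e`, restricted to the domain of `φ` and
  -- relabelled by the pairs `(i, 0)`.
  obtain ⟨b, hb, hbt, hbe⟩ := exists_smoothTriv_restrict (𝓕.smooth e he) φ.open_source
    (zeroOrderEquiv w m k)
  refine ⟨b, hb, hbt.trans ht.baseSet_eq.symm, fun z hz A => ?_⟩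
  have hx : z.toBase ∈ t.baseSet := t.mem_source.1 hz
  obtain ⟨s, hs⟩ := z.exists_eq_jet
  have h1 := ht.coord z.toBase hx s A.1.1 A.1.2
  rw [← hs, partialDeriv, iteratedFDeriv_of_eq_zero
    (show ∑ a, (A.1.2.1 a : ℕ) = 0 from A.2), φ.left_inv (ht.baseSet_eq ▸ hx).2] at h1
  rw [hbe]
  refine Eq.trans ?_ h1.symm
  have h2 : z.toTotal = s.toFun z.toBase := congrArg JetBundle.toTotal hs
  rw [h2]
  rfl

end JetCoords

end FilteredJet

theorem mainTheorem7
    {m : ℕ} {M : Type*} [TopologicalSpace M] [ChartedSpace (FilteredJet.Euc m) M]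
    [IsManifold 𝓘(ℝ, FilteredJet.Euc m) ∞ M] [T2Space M] [SecondCountableTopology M]
    {EF : Type*} [NormedAddCommGroup EF] [NormedSpace ℝ EF]
    {F : Type*} [TopologicalSpace F] [ChartedSpace EF F] [IsManifold 𝓘(ℝ, EF) ∞ F]
    {ι : Type*} [Fintype ι] (π : F → M) (w : ι → ℕ)
    (𝓕 : FilteredJet.FilteredBundle (FilteredJet.Euc m) EF π w)
    (l : ℕ) (hl : ∀ i, w i ≤ l) (k : ℕ) :
    -- a canonical manifold structure on the jet bundle
    ∃ (tJ : TopologicalSpace (FilteredJet.JetBundle m EF π k))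
      (cJ : ChartedSpace (FilteredJet.JetModel ι m k) (FilteredJet.JetBundle m EF π k)),
      IsManifold 𝓘(ℝ, FilteredJet.JetModel ι m k) ∞ (FilteredJet.JetBundle m EF π k) ∧
      T2Space (FilteredJet.JetBundle m EF π k) ∧
      SecondCountableTopology (FilteredJet.JetBundle m EF π k) ∧
      FilteredJet.JetCoordsSmooth 𝓕 k ∧
      (∀ (tJ' : TopologicalSpace (FilteredJet.JetBundle m EF π k))
        (cJ' : ChartedSpace (FilteredJet.JetModel ι m k) (FilteredJet.JetBundle m EF π k)),
        IsManifold 𝓘(ℝ, FilteredJet.JetModel ι m k) ∞ (FilteredJet.JetBundle m EF π k) →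
        FilteredJet.JetCoordsSmooth 𝓕 k → FilteredJet.SameManifold tJ cJ tJ' cJ') ∧
      -- the double filtered structure, whose adapted coordinates are the induced jet coordinates
      (∃ D : FilteredJet.DoubleFilteredBundle (FilteredJet.Euc m) (FilteredJet.JetModel ι m k)
          (FilteredJet.JetBundle.toBase : FilteredJet.JetBundle m EF π k → M)
          (FilteredJet.jetWeight w m k),
        D.atlas = {t | ∃ e ∈ 𝓕.atlas,
          ∃ φ ∈ IsManifold.maximalAtlas 𝓘(ℝ, FilteredJet.Euc m) ∞ M,
            FilteredJet.IsJetTriv e φ t} ∧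
        -- the first filtered structure is over `M`, the second is over `F`
        (∃ S₁ : FilteredJet.FilteredBundle (FilteredJet.Euc m) (FilteredJet.JetModel ι m k)
            (FilteredJet.JetBundle.toBase : FilteredJet.JetBundle m EF π k → M)
            (fun A : {A // (FilteredJet.jetWeight w m k A).1 ≠ 0} =>
              (FilteredJet.jetWeight w m k A).1),
          FilteredJet.IsStructureOver D (fun A => (FilteredJet.jetWeight w m k A).1)
            (id : M → M) S₁) ∧
        (∃ S₂ : FilteredJet.FilteredBundle EF (FilteredJet.JetModel ι m k)
            (FilteredJet.JetBundle.toTotal : FilteredJet.JetBundle m EF π k → F)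
            (fun A : {A // (FilteredJet.jetWeight w m k A).2 ≠ 0} =>
              (FilteredJet.jetWeight w m k A).2),
          FilteredJet.IsStructureOver D (fun A => (FilteredJet.jetWeight w m k A).2) π S₂)) ∧
      -- the bi-degree is `(l, k)`
      (∀ A, (FilteredJet.jetWeight w m k A).1 ≤ l ∧ (FilteredJet.jetWeight w m k A).2 ≤ k) ∧
      (∀ i, ∀ v ≤ k, (0 < m ∨ v = 0) → ∃ A, FilteredJet.jetWeight w m k A = (w i, v)) := by
  let T := (FilteredJet.jetCore 𝓕 k).toTopologicalSpace
  let C := (FilteredJet.jetCore 𝓕 k).toChartedSpace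
  have h : FilteredJet.JetCoordsSmooth 𝓕 k := FilteredJet.jetCoordsSmooth_jetCore 𝓕 k
  refine ⟨T, C, FilteredJet.isManifold_jetCore 𝓕 k, FilteredJet.t2Space_jetBundle 𝓕 h,
    FilteredJet.secondCountableTopology_jetBundle 𝓕 h, h, fun T' C' _ h' => ?_,
    ⟨FilteredJet.jetDoubleFiltered 𝓕 h, rfl, FilteredJet.exists_isStructureOver_base 𝓕 h,
      FilteredJet.exists_isStructureOver_total 𝓕 h⟩, fun A => ⟨hl A.1, A.2.2⟩, fun i v hv hm => ?_⟩
  · exact ⟨FilteredJet.contMDiff_id_of_jetCoordsSmooth 𝓕 h h',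
      FilteredJet.contMDiff_id_of_jetCoordsSmooth 𝓕 h' h⟩
  · obtain ⟨α, hα⟩ := FilteredJet.exists_multiIndex hv hm
    exact ⟨(i, α), Prod.ext rfl hα⟩
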